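/- **Setting.** A FIFO system $\mathcal S=(A_p)_{p\in P}$ consists of a finite set $P$ of processes and, for each $p\in P$, a finite automaton $A_p=(Q_p,\delta_p,q^0_p)$ (nondeterministic, no final states) whose transitions are labelled by actions of $p$: sends $pq!m$, receives $qp?m$ (with $q\in P\setminus\{p\}$), or internal actions of $p$, one of which, $\mathrm{crash}_p$, is reserved for the crash of $p$. Messages $m$ come from $\Sigma\uplus\{\lightning\}$, where $\Sigma$ is finite and $\lightning$ is the crash message. The system is run from the initial control states and empty channels, with one perfect FIFO channel for each ordered pair of distinct processes; an internal action only changes the local state. **Crash-handling.** Let $\delta_{p,1}\subseteq\delta_p$ be the transitions labelled by a send or receive of a message of $\Sigma$, and $\delta_{p,2}=\delta_p\setminus\delta_{p,1}$. The system is *crash-handling* for a set $R\subseteq P$ of reliable processes if, for every $p\in P$, there is a partition $Q_p=Q_{p,1}\uplus Q_{p,2}\uplus Q_{p,3}$ such that the transitions of $\delta_{p,1}$ go from $Q_{p,1}$ to $Q_{p,1}\cup Q_{p,2}$, and $\delta_{p,2}$ is a minimal set $T$ of transitions with the following properties: 1. (crash handling) for each $(q,rp?a,q')\in\delta_{p,1}$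 with $r\notin R$ such that some reachable configuration of $\mathcal S$ has $p$ in state $q$, there is $q''\in Q_{p,1}\cup Q_{p,2}$ with $(q,rp?\lightning,q'')\in T$; 2. (crash broadcast) if $p\notin R$, then for each $q\in Q_{p,1}$ there is a path of transitions of $T$ from $q$ to some state of $Q_{p,2}$, with all intermediate states in $Q_{p,3}$, labelled by $\mathrm{crash}_p\cdot pr_1!\lightning\cdots pr_n!\lightning$, where $r_1,\dots,r_n$ lists $P\setminus\{p\}$ without repetition; 3. (crash redundancy) $(q,rp?\lightning,q)\in T$ for all $q\in Q_{p,2}$ and $r\in P\setminus\{p\}$. **RSC.** In a sequence of actions $e=a_1\cdots a_n$, a *matching pair* is a set $\{j,j'\}$ with $j<j'$ such that, for some channel $pq$, message $m$ and number $k$, $a_j=pq!m$ is the $k$-th send on $pq$ and $a_{j'}=pq?m$ is the $k$-th receive on $pq$. The *interactions* of $e$ are its matching pairs, the singletons $\{j\}$ with $a_j$ a send in no matching pair, and the singletons $\{j\}$ with $a_j$ internal. A *valid communication* of $e$ is a set $C$ of interactions such that each $j\in\{1,\dots,n\}$ lies in exactly one element of $C$. The conflict graph of $(e,C)$ has vertex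 set $C$, each vertex labelled by the actions that it contains, and an edge $\chi_1\to\chi_2$ whenever there are $j_1\in\chi_1$, $j_2\in\chi_2$ with $j_1<j_2$ such that $a_{j_1},a_{j_2}$ are performed by the same process or $\{j_1,j_2\}\in C$. The pair $(e,C)$ is *RSC* if all matching pairs in $C$ are of the form $\{j,j+1\}$. The system $\mathcal S$ is *RSC* if for every execution $e$ of $\mathcal S$ and every valid communication $C$ of $e$ there are a sequence of actions $e'$ and a valid communication $C'$ of $e'$ such that $(e',C')$ is RSC and the labelled conflict graphs of $(e,C)$ and $(e',C')$ are isomorphic. **Theorem.** Given a crash-handling FIFO system $\mathcal S$, it is decidable whether $\mathcal S$ is RSC: there is an algorithm that, given (a finite description of) any FIFO system $\mathcal S$ that is crash-handling for some set of reliable processes, decides whether $\mathcal S$ is RSC. -/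

import Mathlib

namespace CrashFIFO

/-- Messages: the ordinary letters of the alphabet (coded by natural numbers), together with the
distinguished crash message. -/
inductive Msg where
  | data (a : ℕ)
  | crash

/-- Actions. Processes are named by natural numbers, and the channel from `p` to `q` is `(p, q)`.
`send p q m`: process `p` puts `m` on the channel `(p, q)`.
`recv p q m`: process `q` takes `m` from the channel `(p, q)`.
`internal p c`: process `p` performs its internal action number `c`. -/
inductive Action where
  | send (p q : ℕ) (m : Msg)
  | recv (p q : ℕ) (m : Msg)
  | internal (p c : ℕ)

namespace Action

/-- The active process of an action. -/
def proc : Action → ℕ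
  | send p _ _ => p
  | recv _ q _ => q
  | internal p _ => p

/-- The internal action reserved for the crash of process `p`. -/
def crashOf (p : ℕ) : Action := internal p 0

/-- Sends and receives of ordinary (non-crash) messages. -/
def IsOrdinary : Action → Prop
  | send _ _ (Msg.data _) => True
  | recv _ _ (Msg.data _) => True
  | _ => False

/-- Send actions on the channel `(p, q)`. -/
def IsSendOn (p q : ℕ) : Action → Prop
  | send p' q' _ => p' = p ∧ q' = q
  | _ => False

/-- Receive actions on the channel `(p, q)`. -/
def IsRecvOn (p q : ℕ) : Action → Prop
  | recv p' q' _ => p' = p ∧ q' = q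
  | _ => False

instance (p q : ℕ) : DecidablePred (IsSendOn p q) := fun a => by
  cases a <;> (unfold IsSendOn; infer_instance)

instance (p q : ℕ) : DecidablePred (IsRecvOn p q) := fun a => by
  cases a <;> (unfold IsRecvOn; infer_instance)

/-- The channel of a communication joins two different processes among `0, …, n - 1`;
an internal action has no channel. -/
def ValidChannel (n : ℕ) : Action → Prop
  | send p q _ => p < n ∧ q < n ∧ p ≠ q
  | recv p q _ => p < n ∧ q < n ∧ p ≠ q
  | internal _ _ => True

end Action

/-- A transition: source state, action, target state. -/
abbrev Transition := ℕ × Action × ℕ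

/-- A FIFO automaton; its control states are `0, …, numStates - 1`. -/
structure FIFOAutomaton where
  numStates : ℕ
  init : ℕ
  trans : List Transition

/-- A FIFO system, given as the list of its automata; the automaton number `p` of the list is the
one of process `p`. -/
structure FIFOSystem where
  automata : List FIFOAutomaton

/-! ### Coding of systems as finite data, for computability -/

def Msg.equiv : Msg ≃ Option ℕ where
  toFun
    | Msg.data a => some a
    | Msg.crash => none
  invFun
    | some a => Msg.data a
    | none => Msg.crash
  left_inv := by rintro (_ | _) <;> rfl
  right_inv := by rintro (_ | _) <;> rfl

instance : Primcodable Msg := Primcodable.ofEquiv _ Msg.equiv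

def Action.equiv : Action ≃ (ℕ × ℕ × Msg) ⊕ (ℕ × ℕ × Msg) ⊕ (ℕ × ℕ) where
  toFun
    | Action.send p q m => Sum.inl (p, q, m)
    | Action.recv p q m => Sum.inr (Sum.inl (p, q, m))
    | Action.internal p c => Sum.inr (Sum.inr (p, c))
  invFun
    | Sum.inl (p, q, m) => Action.send p q m
    | Sum.inr (Sum.inl (p, q, m)) => Action.recv p q m
    | Sum.inr (Sum.inr (p, c)) => Action.internal p c
  left_inv := by rintro (_ | _ | _) <;> rfl
  right_inv := by rintro (⟨_, _, _⟩ | ⟨_, _, _⟩ | ⟨_, _⟩) <;> rfl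

instance : Primcodable Action := Primcodable.ofEquiv _ Action.equiv

def FIFOAutomaton.equiv : FIFOAutomaton ≃ ℕ × ℕ × List Transition where
  toFun A := (A.numStates, A.init, A.trans)
  invFun x := ⟨x.1, x.2.1, x.2.2⟩
  left_inv := by rintro ⟨_, _, _⟩; rfl
  right_inv := by rintro ⟨_, _, _⟩; rfl

instance : Primcodable FIFOAutomaton := Primcodable.ofEquiv _ FIFOAutomaton.equiv

def FIFOSystem.equiv : FIFOSystem ≃ List FIFOAutomaton where
  toFun S := S.automata
  invFun l := ⟨l⟩
  left_inv := by rintro ⟨_⟩; rfl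
  right_inv := fun _ => rfl

instance : Primcodable FIFOSystem := Primcodable.ofEquiv _ FIFOSystem.equiv

namespace FIFOSystem

/-- The number of processes; the processes are `0, …, numProcs - 1`. -/
def numProcs (S : FIFOSystem) : ℕ := S.automata.length

/-- The automaton of process `p` (an empty automaton if `p` is not a process of the system). -/
def aut (S : FIFOSystem) (p : ℕ) : FIFOAutomaton := S.automata.getD p ⟨0, 0, []⟩

/-- The set of control states of process `p`. -/
def states (S : FIFOSystem) (p : ℕ) : Set ℕ := {q | q < (S.aut p).numStates}

/-- The transition relation of process `p`. -/
def delta (S : FIFOSystem) (p : ℕ) : Set Transition := {t | t ∈ (S.aut p).trans}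

/-- The data is a FIFO system: for every process `p`, the initial state and the end points of the
transitions are control states of `p`, and `p` fires only its own actions, on actual channels. -/
def WellFormed (S : FIFOSystem) : Prop :=
  ∀ p < S.numProcs, (S.aut p).init ∈ S.states p ∧
    ∀ t ∈ S.delta p, t.1 ∈ S.states p ∧ t.2.2 ∈ S.states p ∧
      t.2.1.proc = p ∧ t.2.1.ValidChannel S.numProcs

end FIFOSystem

/-- Configurations: a control state for each process, and a content for each channel. -/
structure Config where
  state : ℕ → ℕ
  chan : ℕ × ℕ → List Msg

namespace FIFOSystem

/-- The initial configuration: initial control states, empty channels. -/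
def initConfig (S : FIFOSystem) : Config where
  state p := (S.aut p).init
  chan _ := []

/-- One step of the system, with perfect FIFO channels. -/
inductive Step (S : FIFOSystem) : Config → Action → Config → Prop
  | send (γ : Config) (p q : ℕ) (m : Msg) (s : ℕ)
      (h : (γ.state p, Action.send p q m, s) ∈ S.delta p) :
      Step S γ (Action.send p q m)
        ⟨Function.update γ.state p s, Function.update γ.chan (p, q) (γ.chan (p, q) ++ [m])⟩
  | recv (γ : Config) (p q : ℕ) (m : Msg) (s : ℕ) (w : List Msg)
      (h : (γ.state q, Action.recv p q m, s) ∈ S.delta q) (hw : γ.chan (p, q) = m :: w) :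
      Step S γ (Action.recv p q m)
        ⟨Function.update γ.state q s, Function.update γ.chan (p, q) w⟩
  | internal (γ : Config) (p c s : ℕ)
      (h : (γ.state p, Action.internal p c, s) ∈ S.delta p) :
      Step S γ (Action.internal p c) ⟨Function.update γ.state p s, γ.chan⟩

/-- `Run S γ e γ'`: the sequence of actions `e` leads from `γ` to `γ'`. -/
inductive Run (S : FIFOSystem) : Config → List Action → Config → Prop
  | nil (γ : Config) : Run S γ [] γ
  | cons {γ γ₁ γ₂ : Config} {a : Action} {e : List Action}
      (h : S.Step γ a γ₁) (t : Run S γ₁ e γ₂) : Run S γ (a :: e) γ₂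

/-- The executions of the system. -/
def exec (S : FIFOSystem) : Set (List Action) := {e | ∃ γ, S.Run S.initConfig e γ}

/-- Some reachable configuration has process `p` in control state `q`. -/
def StateReachable (S : FIFOSystem) (p q : ℕ) : Prop :=
  ∃ e γ, S.Run S.initConfig e γ ∧ γ.state p = q

end FIFOSystem

/-! ### Crash-handling systems -/

/-- The three blocks into which the control states of each process are divided. -/
inductive Block where
  | one
  | two
  | three

/-- `PathVia T Z q as q'`: there is a path of transitions in `T` from `q` to `q'` labelled by the
sequence `as`, all of whose intermediate states are in `Z`. -/
def PathVia (T : Set Transition) (Z : Set ℕ) : ℕ → List Action → ℕ → Prop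
  | q, [], q' => q = q'
  | q, [a], q' => (q, a, q') ∈ T
  | q, a :: b :: as, q' => ∃ s ∈ Z, (q, a, s) ∈ T ∧ PathVia T Z s (b :: as) q'

namespace FIFOSystem

/-- The control states of process `p` that lie in the block `b`. -/
def blockStates (S : FIFOSystem) (blk : ℕ → ℕ → Block) (p : ℕ) (b : Block) : Set ℕ :=
  {q | q ∈ S.states p ∧ blk p q = b}

/-- The transitions of process `p` that send or receive an ordinary message. -/
def delta₁ (S : FIFOSystem) (p : ℕ) : Set Transition := {t | t ∈ S.delta p ∧ t.2.1.IsOrdinary}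

/-- The other transitions of process `p`: those that send or receive the crash message, and the
internal ones. -/
def delta₂ (S : FIFOSystem) (p : ℕ) : Set Transition := {t | t ∈ S.delta p ∧ ¬ t.2.1.IsOrdinary}

/-- Crash handling, for a set `T` of transitions of process `p`: a reachable control state that
receives an ordinary message from an unreliable process also has a branch that receives the crash
message from it. -/
def CrashHandling (S : FIFOSystem) (R : Set ℕ) (blk : ℕ → ℕ → Block) (p : ℕ)
    (T : Set Transition) : Prop :=
  ∀ q r a q', (q, Action.recv r p (Msg.data a), q') ∈ S.delta₁ p → S.StateReachable p q → r ∉ R →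
    ∃ q'' ∈ S.blockStates blk p Block.one ∪ S.blockStates blk p Block.two,
      (q, Action.recv r p Msg.crash, q'') ∈ T

/-- Crash broadcast, for a set `T` of transitions of process `p`: if `p` is unreliable, then from
each state of the first block it can crash and then send the crash message to every other process
once, in some order (the list `rs`). -/
def CrashBroadcast (S : FIFOSystem) (R : Set ℕ) (blk : ℕ → ℕ → Block) (p : ℕ)
    (T : Set Transition) : Prop :=
  p ∉ R → ∀ q ∈ S.blockStates blk p Block.one,
    ∃ qs ∈ S.blockStates blk p Block.two, ∃ rs : List ℕ,
      rs.Nodup ∧ (∀ r, r ∈ rs ↔ r < S.numProcs ∧ r ≠ p) ∧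
      PathVia T (S.blockStates blk p Block.three) q
        (Action.crashOf p :: rs.map (fun r => Action.send p r Msg.crash)) qs

/-- Crash redundancy, for a set `T` of transitions of process `p`: in the states of the second
block, crash messages from any other process can be consumed. -/
def CrashRedundancy (S : FIFOSystem) (blk : ℕ → ℕ → Block) (p : ℕ) (T : Set Transition) : Prop :=
  ∀ q ∈ S.blockStates blk p Block.two, ∀ r < S.numProcs, r ≠ p →
    (q, Action.recv r p Msg.crash, q) ∈ T

/-- Process `p` has crash-handling behaviour in `S`, for the set `R` of reliable processes and the
division `blk` of the states: the ordinary transitions start in the first block and end in the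
first or second one, and the set of the other transitions is minimal among the sets of transitions
that satisfy the three conditions. -/
def HasCrashHandlingBehaviour (S : FIFOSystem) (R : Set ℕ) (blk : ℕ → ℕ → Block) (p : ℕ) : Prop :=
  (∀ t ∈ S.delta₁ p, t.1 ∈ S.blockStates blk p Block.one ∧
    t.2.2 ∈ S.blockStates blk p Block.one ∪ S.blockStates blk p Block.two) ∧
  Minimal (fun T : Set Transition =>
    S.CrashHandling R blk p T ∧ S.CrashBroadcast R blk p T ∧ S.CrashRedundancy blk p T) (S.delta₂ p)

/-- `S` is a crash-handling system, `R` being the set of reliable processes. -/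
def IsCrashHandling (S : FIFOSystem) (R : Set ℕ) : Prop :=
  ∃ blk : ℕ → ℕ → Block, ∀ p < S.numProcs, S.HasCrashHandlingBehaviour R blk p

end FIFOSystem

/-! ### RSC systems. The positions of a sequence of actions are numbered from `0`. -/

/-- `{j, j'}` is a matching pair of `e`: for some channel, message `m` and number `k`, the action at
`j` is the `k`-th send on the channel, the action at `j'` is the `k`-th receive on the channel, both
are about the message `m`, and `j` comes first. -/
def IsMatchingPair (e : List Action) (j j' : ℕ) : Prop :=
  j < j' ∧ ∃ p q m, e[j]? = some (Action.send p q m) ∧ e[j']? = some (Action.recv p q m) ∧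
    (e.take j).countP (fun a => Action.IsSendOn p q a) =
      (e.take j').countP (fun a => Action.IsRecvOn p q a)

/-- The interactions of `e`: matching pairs, unmatched sends, and internal actions. -/
def IsInteraction (e : List Action) (χ : Finset ℕ) : Prop :=
  (∃ j j', IsMatchingPair e j j' ∧ χ = {j, j'}) ∨
  (∃ j p q m, e[j]? = some (Action.send p q m) ∧ (∀ j', ¬ IsMatchingPair e j j') ∧ χ = {j}) ∨
  (∃ j p c, e[j]? = some (Action.internal p c) ∧ χ = {j})

/-- `C` is a valid communication of `e`: it consists of interactions of `e`, and every position of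
`e` belongs to exactly one of them. -/
def IsCommunication (e : List Action) (C : Set (Finset ℕ)) : Prop :=
  (∀ χ ∈ C, IsInteraction e χ) ∧ ∀ j < e.length, ∃! χ, χ ∈ C ∧ j ∈ χ

/-- The actions at the positions `j` and `j'` commute: their active processes differ, and they do
not form a matching pair. -/
def ActionsCommute (e : List Action) (C : Set (Finset ℕ)) (j j' : ℕ) : Prop :=
  (e[j]?).map Action.proc ≠ (e[j']?).map Action.proc ∧ ({j, j'} : Finset ℕ) ∉ C

/-- The order of conflicting actions. -/
def Prec (e : List Action) (C : Set (Finset ℕ)) (j j' : ℕ) : Prop :=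
  j < j' ∧ j' < e.length ∧ ¬ ActionsCommute e C j j'

/-- The edges of the conflict graph of `(e, C)`, whose vertex set is `C`. -/
def ConflictEdge (e : List Action) (C : Set (Finset ℕ)) (χ₁ χ₂ : C) : Prop :=
  ∃ j₁ ∈ χ₁.1, ∃ j₂ ∈ χ₂.1, Prec e C j₁ j₂

/-- The label of a vertex of the conflict graph: the actions that make up the interaction. -/
def label (e : List Action) (χ : Finset ℕ) : Multiset (Option Action) :=
  χ.val.map (fun j => e[j]?)

/-- Causal equivalence: the conflict graphs, whose vertices are labelled by their actions, are
isomorphic. -/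
def CausallyEquivalent (e : List Action) (C : Set (Finset ℕ))
    (e' : List Action) (C' : Set (Finset ℕ)) : Prop :=
  ∃ f : ConflictEdge e C ≃r ConflictEdge e' C', ∀ χ : C, label e χ.1 = label e' (f χ).1

/-- The execution `(e, C)` is RSC: each matching pair in `C` is of the form `{j, j + 1}`. -/
def IsRSCExecution (e : List Action) (C : Set (Finset ℕ)) : Prop :=
  ∀ j j', IsMatchingPair e j j' → ({j, j'} : Finset ℕ) ∈ C → j' = j + 1

/-- The system is RSC: each of its executions is causally equivalent to an RSC execution. -/
def FIFOSystem.IsRSC (S : FIFOSystem) : Prop :=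
  ∀ e ∈ S.exec, ∀ C, IsCommunication e C →
    ∃ e' C', IsCommunication e' C' ∧ IsRSCExecution e' C' ∧ CausallyEquivalent e C e' C'

end CrashFIFO

namespace CrashFIFO

open Relation

/-! An execution is in normal form when it is the flattening of a list of moves: a send with its
receive right behind it, a send that is never received, or an internal action. The FIFO discipline
then amounts to `Ordered`: once a message has been left on a channel, no later message of that
channel is received. For a well-formed system, being RSC turns out to be equivalent to the absence
of a `Borderline` execution: a normal form that can be prolonged by the receive of a waiting message
whose receiver is already causally after its sending. Causality is computed with every matching pair
contracted to one vertex, so a communication transmits it in both directions (`Move.spread`).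

A borderline execution yields a cycle of the conflict graph through the new matching pair. The
interactions of an RSC execution, on the other hand, are linearly ordered compatibly with the graph
(`exists_rank`), so no equivalent RSC execution exists (`Borderline.not_isRSC`).

Without borderline executions, every execution is brought to normal form by induction on its length
(`Run.exists_ordered`). Only a receive needs work: its send is the first waiting one of the channel,
the moves that are not causally after this send commute to its front, and the remaining ones do not
involve the receiver (`exists_split`), so the receive can slide back to its send. The projections to
the processes do not change, and they determine the matching pairs and the labelled conflict graph
(`causallyEquivalent_of_proj_eq`).

Finally, borderline executions are found by a finite search. What must be remembered of a normal
form is the tuple of control states and, for the first waiting message of each channel, the set of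
processes causally after its sending. Both range over finite sets (`finite_searchReach`), and this
data is updated exactly by each move (`borderline_iff`). -/

theorem primrecRel_mem {α : Type*} [Primcodable α] : PrimrecRel fun (b : α) (L : List α) => b ∈ L :=
  (PrimrecRel.exists_mem_list (R := fun x y : α => x = y) Primrec.eq).swap.of_eq
    fun a L => by simp [Function.swap]

/-! ### Computable reachability in finite transition systems -/

section Reachability

variable {α β : Type*}

/-- The elements found by a breadth-first search of depth `k`. -/
def searchLayers (init : α → β) (succ : α → β → List β) (a : α) (k : ℕ) : List β :=
  Nat.rec [init a] (fun _ L => L ++ L.flatMap (succ a)) k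

theorem searchLayers_succ (init : α → β) (succ : α → β → List β) (a : α) (k : ℕ) :
    searchLayers init succ a (k + 1) =
      searchLayers init succ a k ++ (searchLayers init succ a k).flatMap (succ a) := rfl

theorem searchLayers_sound {init : α → β} {succ : α → β → List β} {a : α} {k : ℕ} {b : β}
    (h : b ∈ searchLayers init succ a k) :
    ReflTransGen (fun x y => y ∈ succ a x) (init a) b := by
  induction k generalizing b with
  | zero =>
    obtain rfl : b = init a := by simpa [searchLayers] using h
    exact .refl
  | succ k ih =>
    rw [searchLayers_succ, List.mem_append, List.mem_flatMap] at h
    rcases h with h | ⟨x, hx, h⟩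
    · exact ih h
    · exact (ih hx).tail h

theorem mem_searchLayers_of_closed {init : α → β} {succ : α → β → List β} {a : α} {k : ℕ}
    (hc : ∀ b ∈ searchLayers init succ a k, ∀ c ∈ succ a b, c ∈ searchLayers init succ a k)
    {b : β} (h : ReflTransGen (fun x y => y ∈ succ a x) (init a) b) :
    b ∈ searchLayers init succ a k := by
  induction h with
  | refl =>
    clear hc
    induction k with
    | zero => simp [searchLayers]
    | succ k ih => rw [searchLayers_succ]; exact List.mem_append_left _ ih
  | tail _ h ih => exact hc _ ih _ h

/-- The layers form an increasing chain of subsets of the finite reachable set, so the chain is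
stationary from some depth on; a layer equal to the next one is closed under successors. -/
theorem exists_closed_searchLayers {init : α → β} {succ : α → β → List β} {a : α}
    (hfin : {b | ReflTransGen (fun x y => y ∈ succ a x) (init a) b}.Finite) :
    ∃ k, ∀ b ∈ searchLayers init succ a k, ∀ c ∈ succ a b, c ∈ searchLayers init succ a k := by
  classical
  let F : ℕ →o {s : Finset β // s ⊆ hfin.toFinset} :=
    ⟨fun k => ⟨(searchLayers init succ a k).toFinset, fun b hb => by
        simpa using searchLayers_sound (List.mem_toFinset.1 hb)⟩,
      monotone_nat_of_le_succ fun k b hb => by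
        rw [List.mem_toFinset] at hb ⊢
        rw [searchLayers_succ]
        exact List.mem_append_left _ hb⟩
  have : Finite {s : Finset β // s ⊆ hfin.toFinset} :=
    Set.Finite.to_subtype ((hfin.toFinset.powerset).finite_toSet.subset fun s hs =>
      Finset.mem_coe.2 (Finset.mem_powerset.2 hs))
  obtain ⟨k, hk⟩ := WellFoundedGT.monotone_chain_condition F
  refine ⟨k, fun b hb c hc => ?_⟩
  have h := congrArg (fun s : {s : Finset β // s ⊆ hfin.toFinset} => c ∈ s.1) (hk (k + 1) (by omega))
  simp only [F, OrderHom.coe_mk, List.mem_toFinset] at h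
  rw [h, searchLayers_succ]
  exact List.mem_append_right _ (List.mem_flatMap.2 ⟨b, hb, hc⟩)

variable [Primcodable α] [Primcodable β]

theorem primrec_searchLayers {init : α → β} {succ : α → β → List β} (hinit : Primrec init)
    (hsucc : Primrec₂ succ) : Primrec₂ (searchLayers init succ) := by
  refine Primrec.nat_rec (g := fun a p => p.2 ++ p.2.flatMap (succ a))
    (Primrec.list_cons.comp hinit (.const [])) ?_
  have h2 : Primrec fun p : α × ℕ × List β => p.2.2 := Primrec.snd.comp .snd
  exact Primrec.list_append.comp h2
    (Primrec.list_flatMap h2 (hsucc.comp (Primrec.fst.comp .fst) .snd))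

/-- Safety of a finite transition system is decidable, uniformly in a parameter. -/
theorem exists_computable_safety {init : α → β} {succ : α → β → List β} {bad : α → β → Prop}
    (hinit : Primrec init) (hsucc : Primrec₂ succ) (hbad : PrimrecRel bad)
    (hfin : ∀ a, {b | ReflTransGen (fun x y => y ∈ succ a x) (init a) b}.Finite) :
    ∃ f : α → Bool, Computable f ∧ ∀ a, f a = true ↔
      ∀ b, ReflTransGen (fun x y => y ∈ succ a x) (init a) b → ¬ bad a b := by
  classical
  have hL := primrec_searchLayers hinit hsucc
  have hsub : PrimrecRel fun (L M : List β) => ∀ b ∈ L, b ∈ M :=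
    PrimrecRel.forall_mem_list primrecRel_mem
  have hclosed : PrimrecRel fun (a : α) (k : ℕ) =>
      ∀ b ∈ (searchLayers init succ a k).flatMap (succ a), b ∈ searchLayers init succ a k :=
    hsub.comp (Primrec.list_flatMap hL (hsucc.comp (Primrec.fst.comp .fst) .snd)) hL
  have hsafe : PrimrecRel fun (a : α) (k : ℕ) => ∀ b ∈ searchLayers init succ a k, ¬ bad a b :=
    (PrimrecRel.forall_mem_list hbad.not.swap).comp hL Primrec.fst
  -- An answer is given only at a depth where the layer is closed. The depth is found by unbounded
  -- search, so no bound on the number of reachable states has to be computed.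
  let F : α → ℕ → Option Bool := fun a k =>
    if ∀ b ∈ (searchLayers init succ a k).flatMap (succ a), b ∈ searchLayers init succ a k then
      some (decide (∀ b ∈ searchLayers init succ a k, ¬ bad a b)) else none
  have hF : Computable₂ F :=
    (Primrec.ite hclosed (Primrec.option_some.comp hsafe.decide) (.const none)).to_comp
  have key : ∀ a k v, v ∈ F a k → (v = true ↔
      ∀ b, ReflTransGen (fun x y => y ∈ succ a x) (init a) b → ¬ bad a b) := by
    intro a k v hv
    simp only [F] at hv
    split_ifs at hv with hc
    · obtain rfl : decide _ = v := by simpa using hv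
      simp only [List.mem_flatMap, forall_exists_index, and_imp] at hc
      rw [decide_eq_true_iff]
      exact ⟨fun h b hb => h b (mem_searchLayers_of_closed (fun x hx c hcx => hc c x hx hcx) hb),
        fun h b hb => h b (searchLayers_sound hb)⟩
    · simp at hv
  refine ⟨fun a => decide (∀ b, ReflTransGen (fun x y => y ∈ succ a x) (init a) b → ¬ bad a b),
    (Partrec.rfindOpt hF).of_eq_tot fun a => ?_, fun a => by simp⟩
  obtain ⟨k, hk⟩ := exists_closed_searchLayers (hfin a)
  have hdom : (Nat.rfindOpt (F a)).Dom := by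
    refine Nat.rfindOpt_dom.2 ⟨k, decide (∀ b ∈ searchLayers init succ a k, ¬ bad a b), ?_⟩
    have hc : ∀ b ∈ (searchLayers init succ a k).flatMap (succ a),
        b ∈ searchLayers init succ a k := by
      intro b hb
      obtain ⟨x, hx, hb⟩ := List.mem_flatMap.1 hb
      exact hk x hx b hb
    simp only [F]
    rw [if_pos hc]
    rfl
  -- The depth `n` chosen by the search need not be `k`; by `key`, any depth that answers answers
  -- correctly.
  obtain ⟨n, hn⟩ := Nat.rfindOpt_spec (Part.get_mem hdom)
  have h := key a n _ hn
  convert Part.get_mem hdom using 1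
  rw [Bool.eq_iff_iff, h, decide_eq_true_iff]

end Reachability

/-! ### Words of communications -/

/-- The building blocks of RSC executions: a send with its receive right behind it, a send that is
never received, an internal action. -/
inductive Move where
  | sync (p q : ℕ) (m : Msg)
  | lone (p q : ℕ) (m : Msg)
  | inner (p c : ℕ)

namespace Move

/-- The actions of a move. -/
def acts : Move → List Action
  | sync p q m => [Action.send p q m, Action.recv p q m]
  | lone p q m => [Action.send p q m]
  | inner p c => [Action.internal p c]

/-- `x` may come before `y`: no message overtakes an earlier one that is never received. -/
def Before : Move → Move → Prop
  | lone p q _, sync p' q' _ => ¬ (p' = p ∧ q' = q)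
  | _, _ => True

/-- The processes that are causally after `K` once the move is made. -/
def spread (K : Set ℕ) : Move → Set ℕ
  | sync p q _ => {k | k ∈ K ∨ (k = q ∧ p ∈ K) ∨ (k = p ∧ q ∈ K)}
  | _ => K

end Move

/-- The sequence of actions of a list of moves. -/
def flat (l : List Move) : List Action := l.flatMap Move.acts

@[simp] theorem flat_nil : flat [] = [] := rfl

@[simp] theorem flat_cons (x : Move) (l : List Move) : flat (x :: l) = x.acts ++ flat l := rfl

@[simp] theorem flat_append (l l' : List Move) : flat (l ++ l') = flat l ++ flat l' := by
  simp [flat]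

/-- The lists of moves in which no message overtakes an earlier one. -/
abbrev Ordered (l : List Move) : Prop := l.Pairwise Move.Before

/-- The processes that are causally after `K` once the moves of the list are made. -/
def spread (K : Set ℕ) (l : List Move) : Set ℕ := l.foldl Move.spread K

theorem subset_spread (K : Set ℕ) (l : List Move) : K ⊆ spread K l := by
  induction l generalizing K with
  | nil => exact subset_rfl
  | cons x l ih =>
    refine subset_trans ?_ (ih (x.spread K))
    cases x
    · exact fun k hk => Or.inl hk
    · exact subset_rfl
    · exact subset_rfl

/-- `l` contains a send on the channel `(p, q)` that is never received. -/
def HasLone (p q : ℕ) (l : List Move) : Prop := ∃ m, Move.lone p q m ∈ l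

/-- The only forbidden pattern is an unreceived send followed by a communication on the same
channel. Hence a communication can be appended only while nothing waits on its channel, and the
other moves always. -/
theorem ordered_concat_sync {l : List Move} {p q : ℕ} {m : Msg} :
    Ordered (l ++ [Move.sync p q m]) ↔ Ordered l ∧ ¬ HasLone p q l := by
  simp only [Ordered, List.pairwise_append, List.pairwise_singleton, List.mem_singleton,
    forall_eq, true_and, HasLone, not_exists]
  refine and_congr_right fun _ => ⟨fun h m' hm => h _ hm ⟨rfl, rfl⟩, fun h x hx => ?_⟩
  rcases x with _ | ⟨p', q', m'⟩ | _
  · trivial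
  · rintro ⟨rfl, rfl⟩; exact h _ hx
  · trivial

theorem ordered_concat_lone {l : List Move} {p q : ℕ} {m : Msg} :
    Ordered (l ++ [Move.lone p q m]) ↔ Ordered l := by
  simp only [Ordered, List.pairwise_append, List.pairwise_singleton, List.mem_singleton,
    forall_eq, true_and, and_iff_left_iff_imp]
  rintro _ (_ | _ | _) _ <;> trivial

theorem ordered_concat_inner {l : List Move} {p c : ℕ} :
    Ordered (l ++ [Move.inner p c]) ↔ Ordered l := by
  simp only [Ordered, List.pairwise_append, List.pairwise_singleton, List.mem_singleton,
    forall_eq, true_and, and_iff_left_iff_imp]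
  rintro _ (_ | _ | _) _ <;> trivial

/-- After the moves `l`, the message `m` is the first of the channel `(p, q)`, and process `k` is
causally after its sending. -/
def Awaits (l : List Move) (p q : ℕ) (m : Msg) (k : ℕ) : Prop :=
  ∃ l₁ l₂, l = l₁ ++ Move.lone p q m :: l₂ ∧ ¬ HasLone p q l₁ ∧ k ∈ spread {p} l₂

/-- The first unreceived send on the channel is awaited at least by its own sender. This lets the
search read off from its facts which channels are blocked. -/
theorem hasLone_iff_exists_awaits {l : List Move} {p q : ℕ} :
    HasLone p q l ↔ ∃ m k, Awaits l p q m k := by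
  constructor
  · intro h
    induction l with
    | nil => obtain ⟨m, hm⟩ := h; simp at hm
    | cons x l ih =>
      by_cases hx : ∃ m, x = Move.lone p q m
      · obtain ⟨m, rfl⟩ := hx
        exact ⟨m, p, [], l, rfl, by simp [HasLone], subset_spread _ _ rfl⟩
      · obtain ⟨m, hm⟩ := h
        rcases List.mem_cons.1 hm with h | h
        · exact absurd ⟨m, h.symm⟩ hx
        · obtain ⟨m', k, l₁, l₂, rfl, h₁, hk⟩ := ih ⟨m, h⟩
          refine ⟨m', k, x :: l₁, l₂, rfl, ?_, hk⟩
          rintro ⟨m₀, hm₀⟩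
          rcases List.mem_cons.1 hm₀ with h | h
          · exact hx ⟨m₀, h.symm⟩
          · exact h₁ ⟨m₀, h⟩
  · rintro ⟨m, k, l₁, l₂, rfl, -, -⟩
    exact ⟨m, by simp⟩

/-- The last move either comes after the send of the waiting message, and then only enlarges the set
of processes causally after it, or is that send itself. -/
theorem awaits_concat {l : List Move} {x : Move} {p q : ℕ} {m : Msg} {k : ℕ} :
    Awaits (l ++ [x]) p q m k ↔
      (∃ l₁ l₂, l = l₁ ++ Move.lone p q m :: l₂ ∧ ¬ HasLone p q l₁ ∧
        k ∈ x.spread (spread {p} l₂)) ∨ (x = Move.lone p q m ∧ ¬ HasLone p q l ∧ k = p) := by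
  constructor
  · rintro ⟨l₁, l₂, h, h₁, hk⟩
    rcases List.eq_nil_or_concat l₂ with rfl | ⟨l₂, y, rfl⟩
    · obtain ⟨rfl, h⟩ := List.append_inj' h rfl
      obtain rfl : x = _ := by simpa using h
      exact Or.inr ⟨rfl, h₁, hk⟩
    · rw [List.concat_eq_append] at h hk
      rw [← List.cons_append, ← List.append_assoc] at h
      obtain ⟨rfl, h⟩ := List.append_inj' h rfl
      obtain rfl : x = y := by simpa using h
      refine Or.inl ⟨l₁, l₂, rfl, h₁, ?_⟩
      simpa [spread] using hk
  · rintro (⟨l₁, l₂, rfl, h₁, hk⟩ | ⟨rfl, h₁, rfl⟩)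
    · exact ⟨l₁, l₂ ++ [x], by simp, h₁, by simpa [spread] using hk⟩
    · exact ⟨l, [], rfl, h₁, rfl⟩

theorem awaits_concat_sync {l : List Move} {r s : ℕ} {m' : Msg} {p q : ℕ} {m : Msg} {k : ℕ} :
    Awaits (l ++ [Move.sync r s m']) p q m k ↔
      Awaits l p q m k ∨ (k = s ∧ Awaits l p q m r) ∨ (k = r ∧ Awaits l p q m s) := by
  rw [awaits_concat]
  constructor
  · rintro (⟨l₁, l₂, h, h₁, hk | ⟨hk, hk'⟩ | ⟨hk, hk'⟩⟩ | ⟨h, -⟩)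
    · exact Or.inl ⟨l₁, l₂, h, h₁, hk⟩
    · exact Or.inr (Or.inl ⟨hk, l₁, l₂, h, h₁, hk'⟩)
    · exact Or.inr (Or.inr ⟨hk, l₁, l₂, h, h₁, hk'⟩)
    · cases h
  · rintro (⟨l₁, l₂, h, h₁, hk⟩ | ⟨hk, l₁, l₂, h, h₁, hk'⟩ | ⟨hk, l₁, l₂, h, h₁, hk'⟩)
    · exact Or.inl ⟨l₁, l₂, h, h₁, Or.inl hk⟩
    · exact Or.inl ⟨l₁, l₂, h, h₁, Or.inr (Or.inl ⟨hk, hk'⟩)⟩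
    · exact Or.inl ⟨l₁, l₂, h, h₁, Or.inr (Or.inr ⟨hk, hk'⟩)⟩

theorem awaits_concat_lone {l : List Move} {r s : ℕ} {m' : Msg} {p q : ℕ} {m : Msg} {k : ℕ} :
    Awaits (l ++ [Move.lone r s m']) p q m k ↔
      Awaits l p q m k ∨ (r = p ∧ s = q ∧ m' = m ∧ k = p ∧ ¬ HasLone p q l) := by
  rw [awaits_concat, Move.lone.injEq]
  exact or_congr Iff.rfl (by tauto)

theorem awaits_concat_inner {l : List Move} {r c : ℕ} {p q : ℕ} {m : Msg} {k : ℕ} :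
    Awaits (l ++ [Move.inner r c]) p q m k ↔ Awaits l p q m k := by
  rw [awaits_concat]
  simp [Awaits, Move.spread]

/-! ### Runs of the processes, regardless of the channels -/

/-- The actions of process `k` in `e`. -/
def proj (k : ℕ) (e : List Action) : List Action := e.filter (fun a => a.proc = k)

@[simp] theorem proj_nil (k : ℕ) : proj k [] = [] := rfl

@[simp] theorem proj_append (k : ℕ) (e e' : List Action) :
    proj k (e ++ e') = proj k e ++ proj k e' := List.filter_append ..

theorem proj_singleton_self (a : Action) : proj a.proc [a] = [a] := by simp [proj]

theorem proj_singleton_of_ne {k : ℕ} {a : Action} (h : a.proc ≠ k) : proj k [a] = [] := by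
  simp [proj, h]

/-- `LRun δ s e s'`: the transition relation `δ` has a path from `s` to `s'` labelled by `e`. -/
inductive LRun (δ : Set Transition) : ℕ → List Action → ℕ → Prop
  | nil (s : ℕ) : LRun δ s [] s
  | snoc {s s₁ s₂ : ℕ} {e : List Action} {a : Action} (h : LRun δ s e s₁)
      (ha : (s₁, a, s₂) ∈ δ) : LRun δ s (e ++ [a]) s₂

theorem lrun_nil_iff {δ : Set Transition} {s s' : ℕ} : LRun δ s [] s' ↔ s' = s := by
  constructor
  · intro h
    generalize he : ([] : List Action) = e at h
    cases h with
    | nil => rfl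
    | snoc => simp at he
  · rintro rfl; exact .nil _

theorem lrun_concat_iff {δ : Set Transition} {s s' : ℕ} {e : List Action} {a : Action} :
    LRun δ s (e ++ [a]) s' ↔ ∃ s₁, LRun δ s e s₁ ∧ (s₁, a, s') ∈ δ := by
  constructor
  · intro h
    generalize he : e ++ [a] = e' at h
    cases h with
    | nil => simp at he
    | snoc h ha =>
      obtain ⟨rfl, h'⟩ := List.append_inj' he rfl
      obtain rfl := List.singleton_inj.1 h'
      exact ⟨_, h, ha⟩
  · rintro ⟨s₁, h, ha⟩; exact .snoc h ha

namespace FIFOSystem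

/-- The processes can perform the actions of `e`, regardless of the channels, and end in the
control states `σ`. -/
def LocalRun (S : FIFOSystem) (e : List Action) (σ : ℕ → ℕ) : Prop :=
  ∀ k, LRun (S.delta k) (S.aut k).init (proj k e) (σ k)

variable {S : FIFOSystem}

theorem localRun_nil_iff {σ : ℕ → ℕ} : S.LocalRun [] σ ↔ σ = fun k => (S.aut k).init := by
  simp [LocalRun, lrun_nil_iff, funext_iff]

theorem localRun_concat_iff {e : List Action} {a : Action} {σ' : ℕ → ℕ} :
    S.LocalRun (e ++ [a]) σ' ↔ ∃ σ s, S.LocalRun e σ ∧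
      (σ a.proc, a, s) ∈ S.delta a.proc ∧ σ' = Function.update σ a.proc s := by
  constructor
  · intro h
    have ha := h a.proc
    rw [proj_append, proj_singleton_self, lrun_concat_iff] at ha
    obtain ⟨s₁, h₁, hs₁⟩ := ha
    -- The states before `a` are those after it, with the acting process put back to its previous
    -- state.
    refine ⟨Function.update σ' a.proc s₁, σ' a.proc, fun k => ?_, by simpa using hs₁, by simp⟩
    rcases eq_or_ne k a.proc with rfl | hk
    · simpa using h₁
    · have := h k
      rw [proj_append, proj_singleton_of_ne hk.symm, List.append_nil] at this
      simpa [hk] using this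
  · rintro ⟨σ, s, h, ha, rfl⟩ k
    rcases eq_or_ne k a.proc with rfl | hk
    · rw [proj_append, proj_singleton_self, lrun_concat_iff]
      exact ⟨_, h _, by simpa using ha⟩
    · rw [proj_append, proj_singleton_of_ne hk.symm, List.append_nil]
      simpa [hk] using h k

theorem LocalRun.congr {e e' : List Action} {σ : ℕ → ℕ} (h : S.LocalRun e σ)
    (he : ∀ k, proj k e = proj k e') : S.LocalRun e' σ := fun k => he k ▸ h k

/-- An RSC execution that can be continued by a receive which makes it non RSC. -/
def Borderline (S : FIFOSystem) : Prop :=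
  ∃ l σ p q m s, Ordered l ∧ S.LocalRun (flat l) σ ∧ Awaits l p q m q ∧
    (σ q, Action.recv p q m, s) ∈ S.delta q

end FIFOSystem

/-! ### The transition system whose safety is checked -/

instance : DecidableEq Msg := Msg.equiv.decidableEq

/-- The kind of an action (`0` for sends, `1` for receives, `2` for internal actions), and its
parameters. -/
def Action.code : Action → ℕ × ℕ × ℕ × Msg
  | send p q m => (0, p, q, m)
  | recv p q m => (1, p, q, m)
  | internal p c => (2, p, c, Msg.crash)

/-- The fact that `m` is the first message of the channel `(p, q)` and that `k` is causally after
its sending is coded by `(p, q, m, k)`. -/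
abbrev Fact := ℕ × ℕ × Msg × ℕ

/-- The control states of the processes, and the facts about the messages that are waiting. -/
abbrev SearchState := List ℕ × List Fact

/-- Some message is waiting on the channel `(p, q)`. -/
def Blocked (B : List Fact) (c : ℕ × ℕ) : Prop := ∃ f ∈ B, (f.1, f.2.1) = c

instance (B : List Fact) (c : ℕ × ℕ) : Decidable (Blocked B c) := by
  unfold Blocked; infer_instance

/-- The fact that follows from `f` by a communication between `c.1` and `c.2`. -/
def relay (c : ℕ × ℕ) (f : Fact) : Option Fact :=
  if f.2.2.2 = c.1 then some (f.1, f.2.1, f.2.2.1, c.2)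
  else if f.2.2.2 = c.2 then some (f.1, f.2.1, f.2.2.1, c.1) else none

/-- The facts after a communication between `c.1` and `c.2`. -/
def relayAll (c : ℕ × ℕ) (B : List Fact) : List Fact := 
  (B.filterMap (relay c)).foldr (fun f L => if f ∈ L then L else f :: L) B

/-- The effect of an unmatched send or of an internal action. -/
def succSingle (x : SearchState) (t : Transition) : List SearchState :=
  if t.2.1.code.1 ≠ 1 ∧ x.1[t.2.1.code.2.1]? = some t.1 then
    [(x.1.set t.2.1.code.2.1 t.2.2,
      if t.2.1.code.1 = 0 ∧ ¬ Blocked x.2 (t.2.1.code.2.1, t.2.1.code.2.2.1) then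
        (t.2.1.code.2.1, t.2.1.code.2.2.1, t.2.1.code.2.2.2, t.2.1.code.2.1) :: x.2 else x.2)]
  else []

/-- The effect of a send with its receive right behind it. -/
def succPair (x : SearchState) (t : Transition × Transition) : List SearchState :=
  if (t.1.2.1.code.1 = 0 ∧ t.2.2.1.code.1 = 1 ∧ t.2.2.1.code.2 = t.1.2.1.code.2) ∧
      x.1[t.1.2.1.code.2.1]? = some t.1.1 ∧ x.1[t.1.2.1.code.2.2.1]? = some t.2.1 ∧
      ¬ Blocked x.2 (t.1.2.1.code.2.1, t.1.2.1.code.2.2.1) then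
    [((x.1.set t.1.2.1.code.2.1 t.1.2.2).set t.1.2.1.code.2.2.1 t.2.2.2,
      relayAll (t.1.2.1.code.2.1, t.1.2.1.code.2.2.1) x.2)]
  else []

namespace FIFOSystem

/-- All transitions of the system. -/
def allTrans (S : FIFOSystem) : List Transition := S.automata.flatMap FIFOAutomaton.trans

/-- The initial state of the search. -/
def searchInit (S : FIFOSystem) : SearchState := (S.automata.map FIFOAutomaton.init, [])

/-- The successors of a state of the search. -/
def searchSucc (S : FIFOSystem) (x : SearchState) : List SearchState :=
  S.allTrans.flatMap (succSingle x) ++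
    S.allTrans.flatMap fun t => S.allTrans.flatMap fun t' => succPair x (t, t')

/-- Some waiting message can be received by a process that is causally after its sending. -/
def SearchBad (S : FIFOSystem) (x : SearchState) : Prop :=
  ∃ t ∈ S.allTrans, ∃ f ∈ x.2, t.2.1.code = (1, f.1, f.2.1, f.2.2.1) ∧ f.2.2.2 = f.2.1 ∧
    x.1[f.2.1]? = some t.1

/-- Reachability in the search. -/
def SearchReach (S : FIFOSystem) (x : SearchState) : Prop :=
  ReflTransGen (fun x y => y ∈ S.searchSucc x) S.searchInit x

end FIFOSystem

/-! ### Primitive recursiveness of the search -/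

section Primrec

theorem primrec_code : Primrec Action.code := by
  have h : Primrec fun a : Action => Action.equiv a := Primrec.of_equiv
  let φ : (ℕ × ℕ × Msg) ⊕ (ℕ × ℕ) → ℕ × ℕ × ℕ × Msg := fun y =>
    Sum.casesOn y (fun x => (1, x)) (fun x => (2, x.1, x.2, Msg.crash))
  have h' : Primrec φ := Primrec.sumCasesOn (g := fun _ x => (1, x))
    (h := fun _ (x : ℕ × ℕ) => (2, x.1, x.2, Msg.crash)) .id (Primrec.pair (.const _) .snd)
    (Primrec.pair (.const _) (Primrec.pair (Primrec.fst.comp .snd)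
      (Primrec.pair (Primrec.snd.comp .snd) (.const _))))
  refine (Primrec.sumCasesOn (g := fun _ x => (0, x)) (h := fun _ y => φ y) h
    (Primrec.pair (.const _) .snd) (h'.comp .snd)).of_eq ?_
  rintro (_ | _ | _) <;> rfl

theorem primrec_automaton_trans : Primrec FIFOAutomaton.trans :=
  (Primrec.snd.comp (Primrec.snd.comp (Primrec.of_equiv (e := FIFOAutomaton.equiv)))).of_eq
    fun _ => rfl

theorem primrec_automaton_init : Primrec FIFOAutomaton.init :=
  (Primrec.fst.comp (Primrec.snd.comp (Primrec.of_equiv (e := FIFOAutomaton.equiv)))).of_eq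
    fun _ => rfl

theorem primrec_automata : Primrec FIFOSystem.automata :=
  (Primrec.of_equiv (e := FIFOSystem.equiv)).of_eq fun _ => rfl

theorem primrec_allTrans : Primrec FIFOSystem.allTrans :=
  Primrec.list_flatMap primrec_automata (primrec_automaton_trans.comp .snd)

theorem primrec_searchInit : Primrec FIFOSystem.searchInit :=
  Primrec.pair (Primrec.list_map primrec_automata (primrec_automaton_init.comp .snd)) (.const [])

theorem primrecRel_blocked : PrimrecRel Blocked :=
  PrimrecRel.exists_mem_list (R := fun (f : Fact) (c : ℕ × ℕ) => (f.1, f.2.1) = c)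
    (Primrec.eq.comp (Primrec.pair (Primrec.fst.comp .fst)
      (Primrec.fst.comp (Primrec.snd.comp .fst))) .snd)

theorem primrec_relay : Primrec₂ relay := by
  have hc₁ : Primrec fun p : (ℕ × ℕ) × Fact => p.1.1 := Primrec.fst.comp .fst
  have hc₂ : Primrec fun p : (ℕ × ℕ) × Fact => p.1.2 := Primrec.snd.comp .fst
  have h₁ : Primrec fun p : (ℕ × ℕ) × Fact => p.2.1 := Primrec.fst.comp .snd
  have h₂ : Primrec fun p : (ℕ × ℕ) × Fact => p.2.2 := Primrec.snd.comp .snd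
  have h₃ : Primrec fun p : (ℕ × ℕ) × Fact => p.2.2.1 := Primrec.fst.comp h₂
  have h₄ : Primrec fun p : (ℕ × ℕ) × Fact => p.2.2.2.1 := Primrec.fst.comp (Primrec.snd.comp h₂)
  have h₅ : Primrec fun p : (ℕ × ℕ) × Fact => p.2.2.2.2 := Primrec.snd.comp (Primrec.snd.comp h₂)
  have hpair {f : (ℕ × ℕ) × Fact → ℕ} (hf : Primrec f) :
      Primrec fun p : (ℕ × ℕ) × Fact => some (p.2.1, p.2.2.1, p.2.2.2.1, f p) :=
    Primrec.option_some.comp (h₁.pair (h₃.pair (h₄.pair hf)))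
  exact Primrec.ite (Primrec.eq.comp h₅ hc₁) (hpair hc₂)
    (Primrec.ite (Primrec.eq.comp h₅ hc₂) (hpair hc₁) (.const none))

theorem primrec_relayAll : Primrec₂ relayAll := by
  refine Primrec.list_foldr (h := fun _ p => if p.1 ∈ p.2 then p.2 else p.1 :: p.2)
    (Primrec.listFilterMap .snd (primrec_relay.comp (Primrec.fst.comp .fst) .snd)) .snd ?_
  have h₁ : Primrec fun p : ((ℕ × ℕ) × List Fact) × Fact × List Fact => p.2.1 :=
    Primrec.fst.comp .snd
  have h₂ : Primrec fun p : ((ℕ × ℕ) × List Fact) × Fact × List Fact => p.2.2 :=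
    Primrec.snd.comp .snd
  exact Primrec.ite (primrecRel_mem.comp h₁ h₂) h₂ (Primrec.list_cons.comp h₁ h₂)

theorem primrec_succSingle : Primrec₂ succSingle := by
  have hc : Primrec fun p : SearchState × Transition => p.2.2.1.code :=
    primrec_code.comp (Primrec.fst.comp (Primrec.snd.comp .snd))
  have hkind := Primrec.fst.comp hc
  have hp := Primrec.fst.comp (Primrec.snd.comp hc)
  have hq := Primrec.fst.comp (Primrec.snd.comp (Primrec.snd.comp hc))
  have hm := Primrec.snd.comp (Primrec.snd.comp (Primrec.snd.comp hc))
  have hσ : Primrec fun p : SearchState × Transition => p.1.1 := Primrec.fst.comp .fst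
  have hB : Primrec fun p : SearchState × Transition => p.1.2 := Primrec.snd.comp .fst
  have hs : Primrec fun p : SearchState × Transition => p.2.1 := Primrec.fst.comp .snd
  have hs' : Primrec fun p : SearchState × Transition => p.2.2.2 :=
    Primrec.snd.comp (Primrec.snd.comp .snd)
  refine Primrec.ite ((Primrec.eq.comp hkind (.const 1)).not.and
    (Primrec.eq.comp (Primrec.list_getElem?.comp hσ hp) (Primrec.option_some.comp hs))) ?_ (.const [])
  refine Primrec.list_cons.comp (Primrec.pair (Primrec.list_set.comp hσ (hp.pair hs')) ?_) (.const [])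
  exact Primrec.ite ((Primrec.eq.comp hkind (.const 0)).and
    (primrecRel_blocked.comp hB (hp.pair hq)).not)
    (Primrec.list_cons.comp (hp.pair (hq.pair (hm.pair hp))) hB) hB

theorem primrec_succPair : Primrec₂ succPair := by
  have ht : Primrec fun p : SearchState × Transition × Transition => p.2.1 := Primrec.fst.comp .snd
  have ht' : Primrec fun p : SearchState × Transition × Transition => p.2.2 := Primrec.snd.comp .snd
  have hc := primrec_code.comp (Primrec.fst.comp (Primrec.snd.comp ht))
  have hc' := primrec_code.comp (Primrec.fst.comp (Primrec.snd.comp ht'))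
  have hp := Primrec.fst.comp (Primrec.snd.comp hc)
  have hq := Primrec.fst.comp (Primrec.snd.comp (Primrec.snd.comp hc))
  have hσ : Primrec fun p : SearchState × Transition × Transition => p.1.1 := Primrec.fst.comp .fst
  have hB : Primrec fun p : SearchState × Transition × Transition => p.1.2 := Primrec.snd.comp .fst
  refine Primrec.ite (PrimrecPred.and ?_ (PrimrecPred.and ?_ (PrimrecPred.and ?_ ?_))) ?_ (.const [])
  · exact (Primrec.eq.comp (Primrec.fst.comp hc) (.const 0)).and
      ((Primrec.eq.comp (Primrec.fst.comp hc') (.const 1)).and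
        (Primrec.eq.comp (Primrec.snd.comp hc') (Primrec.snd.comp hc)))
  · exact Primrec.eq.comp (Primrec.list_getElem?.comp hσ hp)
      (Primrec.option_some.comp (Primrec.fst.comp ht))
  · exact Primrec.eq.comp (Primrec.list_getElem?.comp hσ hq)
      (Primrec.option_some.comp (Primrec.fst.comp ht'))
  · exact (primrecRel_blocked.comp hB (hp.pair hq)).not
  · exact Primrec.list_cons.comp (Primrec.pair
      (Primrec.list_set.comp
        (Primrec.list_set.comp hσ (hp.pair (Primrec.snd.comp (Primrec.snd.comp ht))))
        (hq.pair (Primrec.snd.comp (Primrec.snd.comp ht'))))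
      (primrec_relayAll.comp (hp.pair hq) hB)) (.const [])

theorem primrec_searchSucc : Primrec₂ FIFOSystem.searchSucc := by
  have hT : Primrec fun p : FIFOSystem × SearchState => p.1.allTrans :=
    primrec_allTrans.comp .fst
  refine Primrec.list_append.comp
    (Primrec.list_flatMap hT (primrec_succSingle.comp (Primrec.snd.comp .fst) .snd))
    (Primrec.list_flatMap hT (Primrec.list_flatMap (hT.comp .fst) ?_))
  exact primrec_succPair.comp (Primrec.snd.comp (Primrec.fst.comp .fst))
    (Primrec.pair (Primrec.snd.comp .fst) .snd)

theorem primrecRel_searchBad : PrimrecRel FIFOSystem.SearchBad := by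
  have hR : PrimrecRel fun (f : Fact) (y : Transition × SearchState) =>
      y.1.2.1.code = (1, f.1, f.2.1, f.2.2.1) ∧ f.2.2.2 = f.2.1 ∧ y.2.1[f.2.1]? = some y.1.1 := by
    have hf : Primrec fun y : Fact × Transition × SearchState => y.1 := .fst
    have ht : Primrec fun y : Fact × Transition × SearchState => y.2.1 := Primrec.fst.comp .snd
    have hx : Primrec fun y : Fact × Transition × SearchState => y.2.2.1 :=
      Primrec.fst.comp (Primrec.snd.comp .snd)
    have hq := Primrec.fst.comp (Primrec.snd.comp hf)
    have hmk := Primrec.snd.comp (Primrec.snd.comp hf)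
    refine PrimrecPred.and ?_ (PrimrecPred.and ?_ ?_)
    · exact Primrec.eq.comp (primrec_code.comp (Primrec.fst.comp (Primrec.snd.comp ht)))
        ((Primrec.const 1).pair ((Primrec.fst.comp hf).pair (hq.pair (Primrec.fst.comp hmk))))
    · exact Primrec.eq.comp (Primrec.snd.comp hmk) hq
    · exact Primrec.eq.comp (Primrec.list_getElem?.comp hx hq)
        (Primrec.option_some.comp (Primrec.fst.comp ht))
  have hR' : PrimrecRel fun (t : Transition) (x : SearchState) => ∃ f ∈ x.2,
      t.2.1.code = (1, f.1, f.2.1, f.2.2.1) ∧ f.2.2.2 = f.2.1 ∧ x.1[f.2.1]? = some t.1 :=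
    (PrimrecRel.exists_mem_list hR).comp (Primrec.snd.comp .snd) (Primrec.pair .fst .snd)
  exact (PrimrecRel.exists_mem_list hR').comp (primrec_allTrans.comp .fst) .snd

end Primrec

/-! ### The search is finite -/

theorem finite_lists_of_length_le {α : Type*} {F : Set α} (hF : F.Finite) (n : ℕ) :
    {l : List α | l.length ≤ n ∧ ∀ x ∈ l, x ∈ F}.Finite := by
  induction n with
  | zero =>
    refine (Set.finite_singleton ([] : List α)).subset fun l hl => ?_
    exact List.length_eq_zero_iff.1 (Nat.le_zero.1 hl.1)
  | succ n ih =>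
    refine ((Set.finite_singleton ([] : List α)).union
      (Set.Finite.image2 List.cons hF ih)).subset fun l hl => ?_
    rcases l with _ | ⟨x, l⟩
    · exact Or.inl rfl
    · refine Or.inr ⟨x, hl.2 x (by simp), l, ⟨by simpa using hl.1, fun y hy => hl.2 y (by simp [hy])⟩, rfl⟩

theorem finite_nodup_lists {α : Type*} {F : Set α} (hF : F.Finite) :
    {l : List α | l.Nodup ∧ ∀ x ∈ l, x ∈ F}.Finite := by
  classical
  refine (finite_lists_of_length_le hF hF.toFinset.card).subset fun l hl => ⟨?_, hl.2⟩
  rw [← List.toFinset_card_of_nodup hl.1]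
  exact Finset.card_le_card fun x hx => by simpa using hl.2 x (by simpa using hx)

theorem mem_relayAll {c : ℕ × ℕ} {B : List Fact} {f : Fact} :
    f ∈ relayAll c B ↔ f ∈ B ∨ ∃ g ∈ B, relay c g = some f := by
  rw [← List.mem_filterMap, relayAll]
  induction B.filterMap (relay c) with
  | nil => simp
  | cons g L ih =>
    rw [List.foldr_cons]
    split_ifs with h
    · rw [ih, List.mem_cons]
      constructor
      · tauto
      · rintro (h' | rfl | h')
        · exact Or.inl h'
        · exact ih.1 h
        · exact Or.inr h'
    · rw [List.mem_cons, ih, List.mem_cons]; tauto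

/-- Freeness of duplicates bounds the length of the lists of facts; without it the search could
visit infinitely many lists for finitely many sets. -/
theorem nodup_relayAll {c : ℕ × ℕ} {B : List Fact} (h : B.Nodup) : (relayAll c B).Nodup := by
  rw [relayAll]
  induction B.filterMap (relay c) with
  | nil => exact h
  | cons g L ih =>
    rw [List.foldr_cons]
    split_ifs with h
    · exact ih
    · exact List.nodup_cons.2 ⟨h, ih⟩

namespace FIFOSystem

variable {S : FIFOSystem}

/-- The processes and the other parameters that occur in the actions of the system. -/
def params (S : FIFOSystem) : Set ℕ :=
  {k | ∃ t ∈ S.allTrans, k = t.2.1.code.2.1 ∨ k = t.2.1.code.2.2.1}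

theorem finite_params (S : FIFOSystem) : S.params.Finite := by
  refine ((S.allTrans.map fun t => t.2.1.code.2.1).finite_toSet.union
    (S.allTrans.map fun t => t.2.1.code.2.2.1).finite_toSet).subset ?_
  rintro k ⟨t, ht, rfl | rfl⟩
  · exact Or.inl (List.mem_map.2 ⟨t, ht, rfl⟩)
  · exact Or.inr (List.mem_map.2 ⟨t, ht, rfl⟩)

/-- The facts that can occur in the search. -/
def factRange (S : FIFOSystem) : Set Fact :=
  {f | f.1 ∈ S.params ∧ f.2.1 ∈ S.params ∧ f.2.2.1 ∈ S.allTrans.map (fun t => t.2.1.code.2.2.2) ∧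
    f.2.2.2 ∈ S.params}

theorem finite_factRange (S : FIFOSystem) : S.factRange.Finite := by
  refine (S.finite_params.prod (S.finite_params.prod
    ((S.allTrans.map (fun t => t.2.1.code.2.2.2)).finite_toSet.prod S.finite_params))).subset ?_
  rintro f ⟨h₁, h₂, h₃, h₄⟩
  exact ⟨h₁, h₂, h₃, h₄⟩

/-- The control states that can occur in the search. -/
def stateRange (S : FIFOSystem) : Set ℕ :=
  {s | s ∈ S.automata.map FIFOAutomaton.init ∨ s ∈ S.allTrans.map fun t => t.2.2}

theorem mem_stateRange_of_mem_set {l : List ℕ} {i : ℕ} {t : Transition} (ht : t ∈ S.allTrans)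
    (hl : ∀ s ∈ l, s ∈ S.stateRange) : ∀ s ∈ l.set i t.2.2, s ∈ S.stateRange := by
  intro s hs
  rcases List.mem_or_eq_of_mem_set hs with hs | rfl
  · exact hl s hs
  · exact Or.inr (List.mem_map.2 ⟨t, ht, rfl⟩)

theorem factRange_of_relay {c : ℕ × ℕ} {f g : Fact} (hf : f ∈ S.factRange)
    (h₁ : c.1 ∈ S.params) (h₂ : c.2 ∈ S.params) (h : relay c f = some g) : g ∈ S.factRange := by
  obtain ⟨h₃, h₄, h₅, -⟩ := hf
  unfold relay at h
  split_ifs at h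
  · obtain rfl := Option.some.inj h
    exact ⟨h₃, h₄, h₅, h₂⟩
  · obtain rfl := Option.some.inj h
    exact ⟨h₃, h₄, h₅, h₁⟩

theorem finite_searchReach (S : FIFOSystem) : {x | S.SearchReach x}.Finite := by
  refine ((finite_lists_of_length_le (F := S.stateRange)
    ((List.finite_toSet _).union (List.finite_toSet _)) S.automata.length).prod
    (finite_nodup_lists S.finite_factRange)).subset fun x hx => ?_
  induction hx with
  | refl =>
    refine ⟨⟨by simp [searchInit], fun s hs => Or.inl hs⟩, List.nodup_nil, ?_⟩
    intro f hf
    simp [searchInit] at hf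
  | tail _ hy ih =>
    obtain ⟨⟨h₁, h₂⟩, h₃, h₄⟩ := ih
    rcases List.mem_append.1 hy with hy | hy
    · obtain ⟨t, ht, hy⟩ := List.mem_flatMap.1 hy
      unfold succSingle at hy
      split_ifs at hy with hc hb
      · obtain rfl := List.mem_singleton.1 hy
        refine ⟨⟨by simpa using h₁, mem_stateRange_of_mem_set ht h₂⟩,
          -- The new fact is not in the list, since otherwise its channel would be blocked.
          List.nodup_cons.2 ⟨fun h => hb.2 ⟨_, h, rfl⟩, h₃⟩, ?_⟩
        intro f hf
        rcases List.mem_cons.1 hf with rfl | hf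
        · exact ⟨⟨t, ht, Or.inl rfl⟩, ⟨t, ht, Or.inr rfl⟩, List.mem_map.2 ⟨t, ht, rfl⟩,
            ⟨t, ht, Or.inl rfl⟩⟩
        · exact h₄ f hf
      · obtain rfl := List.mem_singleton.1 hy
        exact ⟨⟨by simpa using h₁, mem_stateRange_of_mem_set ht h₂⟩, h₃, h₄⟩
      · simp at hy
    · obtain ⟨t, ht, hy⟩ := List.mem_flatMap.1 hy
      obtain ⟨t', ht', hy⟩ := List.mem_flatMap.1 hy
      unfold succPair at hy
      split_ifs at hy with hc
      · obtain rfl := List.mem_singleton.1 hy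
        refine ⟨⟨by simpa using h₁,
          mem_stateRange_of_mem_set ht' (mem_stateRange_of_mem_set ht h₂)⟩, nodup_relayAll h₃, ?_⟩
        intro f hf
        rcases mem_relayAll.1 hf with hf | ⟨g, hg, hf⟩
        · exact h₄ f hf
        · exact factRange_of_relay (h₄ g hg) ⟨t, ht, Or.inl rfl⟩ ⟨t, ht, Or.inr rfl⟩ hf
      · simp at hy

/-! ### The search finds the borderline executions -/

/-- In a well-formed system, a transition reveals its owner through the active process of its
action, so the pooled list of transitions loses no information. -/
theorem mem_allTrans (hS : S.WellFormed) {t : Transition} :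
    t ∈ S.allTrans ↔ t ∈ S.delta t.2.1.proc := by
  constructor
  · intro h
    obtain ⟨A, hA, ht⟩ := List.mem_flatMap.1 h
    obtain ⟨k, hk, rfl⟩ := List.mem_iff_getElem.1 hA
    have hd : t ∈ S.delta k := by simpa [delta, aut, List.getD, hk] using ht
    rwa [((hS k hk).2 t hd).2.2.1]
  · intro h
    by_cases hk : t.2.1.proc < S.automata.length
    · exact List.mem_flatMap.2 ⟨_, List.getElem_mem hk, by simpa [delta, aut, List.getD, hk] using h⟩
    · simp [delta, aut, List.getD, hk] at h

/-- Outside the list of processes, `aut` returns an automaton without transitions. -/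
theorem lt_numProcs_of_mem_delta {t : Transition} {k : ℕ} (h : t ∈ S.delta k) : k < S.numProcs := by
  by_contra hk
  simp [delta, aut, List.getD, show ¬ k < S.automata.length from hk] at h

theorem validChannel_of_mem_delta (hS : S.WellFormed) {t : Transition} {k : ℕ}
    (h : t ∈ S.delta k) : t.2.1.ValidChannel S.numProcs :=
  ((hS k (lt_numProcs_of_mem_delta h)).2 t h).2.2.2

/-- The list of the control states of the processes of the system. -/
def stateList (S : FIFOSystem) (σ : ℕ → ℕ) : List ℕ := (List.range S.numProcs).map σ

theorem stateList_getElem? {σ : ℕ → ℕ} {k s : ℕ} :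
    (S.stateList σ)[k]? = some s ↔ k < S.numProcs ∧ σ k = s := by
  by_cases hk : k < S.numProcs <;> simp [stateList, hk]

theorem stateList_set (σ : ℕ → ℕ) (k s : ℕ) :
    (S.stateList σ).set k s = S.stateList (Function.update σ k s) := by
  refine List.ext_getElem (by simp [stateList]) fun i h₁ h₂ => ?_
  simp only [stateList, List.getElem_set, List.getElem_map, List.getElem_range,
    Function.update_apply, eq_comm]

theorem stateList_init : S.stateList (fun k => (S.aut k).init) = S.automata.map FIFOAutomaton.init := by
  refine List.ext_getElem (by simp [stateList, numProcs]) fun i h₁ h₂ => ?_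
  have hi : i < S.automata.length := by simpa using h₂
  simp [stateList, aut, List.getD, hi]

/-- The list `B` holds exactly the facts about the waiting messages after `l`. -/
def Represents (B : List Fact) (l : List Move) : Prop :=
  ∀ p q m k, (p, q, m, k) ∈ B ↔ Awaits l p q m k

theorem Represents.blocked_iff {B : List Fact} {l : List Move} (h : Represents B l) {p q : ℕ} :
    Blocked B (p, q) ↔ HasLone p q l := by
  rw [hasLone_iff_exists_awaits]
  constructor
  · rintro ⟨⟨p', q', m, k⟩, hf, hc⟩
    obtain ⟨rfl, rfl⟩ := Prod.mk.inj hc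
    exact ⟨m, k, (h _ _ _ _).1 hf⟩
  · rintro ⟨m, k, hk⟩
    exact ⟨_, (h _ _ _ _).2 hk, rfl⟩

theorem Represents.sync {B : List Fact} {l : List Move} (h : Represents B l) (r s : ℕ) (m : Msg) :
    Represents (relayAll (r, s) B) (l ++ [Move.sync r s m]) := by
  intro p q m' k
  rw [awaits_concat_sync, mem_relayAll, ← h, ← h, ← h]
  refine or_congr Iff.rfl ⟨?_, ?_⟩
  · rintro ⟨⟨p', q', m'', k'⟩, hg, hf⟩
    unfold relay at hf
    split_ifs at hf with h₁ h₂
    · simp only [Option.some.injEq, Prod.mk.injEq] at hf h₁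
      obtain ⟨rfl, rfl, rfl, rfl⟩ := hf
      exact Or.inl ⟨rfl, h₁ ▸ hg⟩
    · simp only [Option.some.injEq, Prod.mk.injEq] at hf h₂
      obtain ⟨rfl, rfl, rfl, rfl⟩ := hf
      exact Or.inr ⟨rfl, h₂ ▸ hg⟩
  · rintro (⟨rfl, hg⟩ | ⟨rfl, hg⟩)
    · exact ⟨_, hg, by simp [relay]⟩
    · refine ⟨_, hg, ?_⟩
      -- `relay` tests the sender first; when the two ends of the channel coincide, its first branch
      -- yields the same fact.
      by_cases hks : s = k <;> simp [relay, hks]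

theorem Represents.lone {B : List Fact} {l : List Move} (h : Represents B l) (r s : ℕ) (m : Msg) :
    Represents (if ¬ Blocked B (r, s) then (r, s, m, r) :: B else B) (l ++ [Move.lone r s m]) := by
  intro p q m' k
  rw [awaits_concat_lone, ← h]
  split_ifs with hb
  · rw [h.blocked_iff] at hb
    refine ⟨Or.inl, ?_⟩
    rintro (hk | ⟨rfl, rfl, rfl, rfl, hl⟩)
    · exact hk
    · exact absurd hb hl
  · rw [h.blocked_iff] at hb
    simp only [List.mem_cons, Prod.mk.injEq]
    constructor
    · rintro (⟨rfl, rfl, rfl, rfl⟩ | hk)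
      · exact Or.inr ⟨rfl, rfl, rfl, rfl, hb⟩
      · exact Or.inl hk
    · rintro (hk | ⟨rfl, rfl, rfl, rfl, -⟩)
      · exact Or.inr hk
      · exact Or.inl ⟨rfl, rfl, rfl, rfl⟩

theorem Represents.inner {B : List Fact} {l : List Move} (h : Represents B l) (r c : ℕ) :
    Represents B (l ++ [Move.inner r c]) := by
  intro p q m k
  rw [awaits_concat_inner, h]

theorem represents_nil : Represents [] [] := by
  intro p q m k
  simp [Awaits]

/-- Each search step appends one move: the invariant is that the state list comes from a local run
of an ordered list of moves and that the facts are exactly the awaited ones. -/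
theorem SearchReach.sound (hS : S.WellFormed) {x : SearchState} (h : S.SearchReach x) :
    ∃ l σ, Ordered l ∧ S.LocalRun (flat l) σ ∧ x.1 = S.stateList σ ∧ Represents x.2 l := by
  induction h with
  | refl =>
    exact ⟨[], _, .nil, localRun_nil_iff.2 rfl, stateList_init.symm, represents_nil⟩
  | @tail x y _ hy ih =>
    obtain ⟨l, σ, hl, hσ, hx, hB⟩ := ih
    obtain ⟨x₁, B⟩ := x
    obtain rfl : x₁ = S.stateList σ := hx
    rcases List.mem_append.1 hy with hy | hy
    · obtain ⟨⟨s, a, s'⟩, ht, hy⟩ := List.mem_flatMap.1 hy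
      rw [mem_allTrans hS] at ht
      rw [succSingle, List.mem_ite_nil_right, List.mem_singleton] at hy
      obtain ⟨⟨hk, hs⟩, rfl⟩ := hy
      obtain rfl : σ a.code.2.1 = s := (stateList_getElem?.1 hs).2
      have hrun : a.code.2.1 = a.proc →
          S.LocalRun (flat l ++ [a]) (Function.update σ a.code.2.1 s') := by
        intro ha
        rw [ha] at ht ⊢
        exact localRun_concat_iff.2 ⟨σ, s', hσ, ht, rfl⟩
      rcases a with ⟨p, q, m⟩ | ⟨p, q, m⟩ | ⟨p, c⟩
      · refine ⟨l ++ [Move.lone p q m], _, ordered_concat_lone.2 hl, by simpa [Move.acts] using hrun rfl,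
          stateList_set .., ?_⟩
        simpa [Action.code] using hB.lone p q m
      · exact absurd rfl hk
      · refine ⟨l ++ [Move.inner p c], _, ordered_concat_inner.2 hl, by simpa [Move.acts] using hrun rfl,
          stateList_set .., ?_⟩
        simpa [Action.code] using hB.inner p c
    · obtain ⟨⟨s, a, s'⟩, ht, hy⟩ := List.mem_flatMap.1 hy
      obtain ⟨⟨r, b, r'⟩, ht', hy⟩ := List.mem_flatMap.1 hy
      rw [mem_allTrans hS] at ht ht'
      rw [succPair, List.mem_ite_nil_right, List.mem_singleton] at hy
      obtain ⟨⟨⟨hk, hk', hab⟩, hs, hr, hb⟩, rfl⟩ := hy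
      rw [stateList_getElem?] at hs hr
      rcases a with ⟨p, q, m⟩ | ⟨p, q, m⟩ | ⟨p, c⟩
      · rcases b with ⟨p', q', m'⟩ | ⟨p', q', m'⟩ | ⟨p', c'⟩
        · simp [Action.code] at hk'
        · simp only [Action.code, Prod.mk.injEq] at hab hs hr hb ⊢
          obtain ⟨rfl, rfl, rfl⟩ := hab
          obtain ⟨-, rfl⟩ := hs
          obtain ⟨-, rfl⟩ := hr
          -- `succPair` reads both source states before either update; this is harmless because the
          -- send leaves the state of the other process unchanged.
          have hne : p' ≠ q' := (validChannel_of_mem_delta hS ht).2.2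
          refine ⟨l ++ [Move.sync p' q' m'], _,
            ordered_concat_sync.2 ⟨hl, fun h => hb (hB.blocked_iff.2 h)⟩, ?_,
            by rw [stateList_set, stateList_set], hB.sync p' q' m'⟩
          rw [flat_append, flat_cons, flat_nil, List.append_nil, Move.acts,
            ← List.singleton_append, ← List.append_assoc]
          refine localRun_concat_iff.2 ⟨_, r', localRun_concat_iff.2 ⟨σ, s', hσ, ht, rfl⟩, ?_, rfl⟩
          rw [Action.proc, Action.proc, Function.update_of_ne hne.symm]
          exact ht'
        · simp [Action.code] at hk'
      · simp [Action.code] at hk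
      · simp [Action.code] at hk

/-- Completeness of the search: being ordered says precisely that the channel of every communication
is unblocked when the search has to perform it. -/
theorem exists_searchReach (hS : S.WellFormed) {l : List Move} {σ : ℕ → ℕ} (hl : Ordered l)
    (hσ : S.LocalRun (flat l) σ) :
    ∃ B, Represents B l ∧ S.SearchReach (S.stateList σ, B) := by
  induction l using List.reverseRecOn generalizing σ with
  | nil =>
    rw [flat_nil, localRun_nil_iff] at hσ
    subst hσ
    refine ⟨[], represents_nil, ?_⟩
    rw [stateList_init]
    exact .refl
  | append_singleton l x ih =>
    rw [flat_append, flat_cons, flat_nil, List.append_nil] at hσ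
    rcases x with ⟨p, q, m⟩ | ⟨p, q, m⟩ | ⟨p, c⟩
    · rw [ordered_concat_sync] at hl
      rw [Move.acts, ← List.singleton_append, ← List.append_assoc, localRun_concat_iff] at hσ
      obtain ⟨_, r', hσ', ht', rfl⟩ := hσ
      obtain ⟨σ, s', hσ, ht, rfl⟩ := localRun_concat_iff.1 hσ'
      rw [Action.proc] at ht
      rw [Action.proc, Action.proc] at ht' ⊢
      have hne : p ≠ q := (validChannel_of_mem_delta hS ht).2.2
      rw [Function.update_of_ne hne.symm] at ht'
      obtain ⟨B, hB, hreach⟩ := ih hl.1 hσ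
      refine ⟨_, hB.sync p q m, hreach.tail (List.mem_append_right _ (List.mem_flatMap.2
        ⟨_, (mem_allTrans hS).2 ht, List.mem_flatMap.2 ⟨_, (mem_allTrans hS).2 ht', ?_⟩⟩))⟩
      rw [succPair, List.mem_ite_nil_right, List.mem_singleton]
      refine ⟨⟨⟨rfl, rfl, rfl⟩, ?_, ?_, fun h => hl.2 (hB.blocked_iff.1 h)⟩, ?_⟩
      · exact stateList_getElem?.2 ⟨lt_numProcs_of_mem_delta ht, rfl⟩
      · exact stateList_getElem?.2 ⟨lt_numProcs_of_mem_delta ht', rfl⟩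
      · rw [stateList_set, stateList_set]; rfl
    · rw [Move.acts, localRun_concat_iff] at hσ
      obtain ⟨σ, s', hσ, ht, rfl⟩ := hσ
      obtain ⟨B, hB, hreach⟩ := ih (ordered_concat_lone.1 hl) hσ
      refine ⟨_, hB.lone p q m, hreach.tail (List.mem_append_left _ (List.mem_flatMap.2
        ⟨_, (mem_allTrans hS).2 ht, ?_⟩))⟩
      rw [succSingle, List.mem_ite_nil_right, List.mem_singleton]
      refine ⟨⟨by simp [Action.code], ?_⟩, ?_⟩
      · exact stateList_getElem?.2 ⟨lt_numProcs_of_mem_delta ht, rfl⟩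
      · rw [stateList_set]; simp [Action.code, Action.proc]
    · rw [Move.acts, localRun_concat_iff] at hσ
      obtain ⟨σ, s', hσ, ht, rfl⟩ := hσ
      obtain ⟨B, hB, hreach⟩ := ih (ordered_concat_inner.1 hl) hσ
      refine ⟨_, hB.inner p c, hreach.tail (List.mem_append_left _ (List.mem_flatMap.2
        ⟨_, (mem_allTrans hS).2 ht, ?_⟩))⟩
      rw [succSingle, List.mem_ite_nil_right, List.mem_singleton]
      refine ⟨⟨by simp [Action.code], ?_⟩, ?_⟩
      · exact stateList_getElem?.2 ⟨lt_numProcs_of_mem_delta ht, rfl⟩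
      · rw [stateList_set]; simp [Action.code, Action.proc]

theorem borderline_iff (hS : S.WellFormed) :
    S.Borderline ↔ ∃ x, S.SearchReach x ∧ S.SearchBad x := by
  constructor
  · rintro ⟨l, σ, p, q, m, s, hl, hσ, hw, hs⟩
    obtain ⟨B, hB, hx⟩ := exists_searchReach hS hl hσ
    exact ⟨_, hx, _, (mem_allTrans hS).2 hs, _, (hB _ _ _ _).2 hw, rfl, rfl,
      stateList_getElem?.2 ⟨lt_numProcs_of_mem_delta hs, rfl⟩⟩
  · rintro ⟨x, hx, ⟨s, a, s'⟩, ht, ⟨p, q, m, k⟩, hf, ha, hk, hs⟩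
    obtain ⟨l, σ, hl, hσ, hxσ, hB⟩ := hx.sound hS
    simp only at ha hk hs
    subst hk
    rw [mem_allTrans hS] at ht
    rw [hxσ, stateList_getElem?] at hs
    obtain ⟨-, rfl⟩ := hs
    rcases a with _ | ⟨p', q', m'⟩ | _
    · simp [Action.code] at ha
    · simp only [Action.code, Prod.mk.injEq, true_and] at ha
      obtain ⟨rfl, rfl, rfl⟩ := ha
      exact ⟨l, σ, _, _, _, s', hl, hσ, (hB _ _ _ _).1 hf, ht⟩
    · simp [Action.code] at ha

end FIFOSystem

/-- Whether a system has a borderline execution is decidable. -/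
theorem exists_computable_borderline : ∃ f : FIFOSystem → Bool, Computable f ∧
    ∀ S : FIFOSystem, S.WellFormed → (f S = true ↔ ¬ S.Borderline) := by
  obtain ⟨f, hf, h⟩ := exists_computable_safety primrec_searchInit primrec_searchSucc
    primrecRel_searchBad FIFOSystem.finite_searchReach
  refine ⟨f, hf, fun S hS => ?_⟩
  rw [h, FIFOSystem.borderline_iff hS, not_exists]
  simp only [not_and]
  rfl

/-! ### Matching pairs and communications -/

/-- Every receive is preceded by its matching send. -/
def Matched (e : List Action) : Prop :=
  ∀ j' p q m, e[j']? = some (Action.recv p q m) → ∃ j, IsMatchingPair e j j'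

theorem countP_take_lt {P : Action → Bool} {e : List Action} {i j : ℕ} {a : Action} (hij : i < j)
    (ha : e[i]? = some a) (hP : P a) : (e.take i).countP P < (e.take j).countP P := by
  have h : (e.take (i + 1)).countP P = (e.take i).countP P + 1 := by
    rw [List.take_add_one, ha, List.countP_append]
    simp [hP]
  have h' : (e.take (i + 1)).countP P ≤ (e.take j).countP P :=
    (List.take_sublist_take_left (by omega)).countP_le
  omega

/-- The count of the actions satisfying `P` strictly increases past such an action, so their rank
determines their position. This is why a matching pair is determined by either end. -/
theorem eq_of_countP_take_eq {P : Action → Bool} {e : List Action} {i j : ℕ} {a b : Action}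
    (ha : e[i]? = some a) (hPa : P a) (hb : e[j]? = some b) (hPb : P b)
    (h : (e.take i).countP P = (e.take j).countP P) : i = j := by
  rcases lt_trichotomy i j with hij | hij | hij
  · exact absurd h (countP_take_lt hij ha hPa).ne
  · exact hij
  · exact absurd h (countP_take_lt hij hb hPb).ne'

theorem IsMatchingPair.left_unique {e : List Action} {i i' j : ℕ} (h : IsMatchingPair e i j)
    (h' : IsMatchingPair e i' j) : i = i' := by
  obtain ⟨-, p, q, m, hs, hr, hc⟩ := h
  obtain ⟨-, p', q', m', hs', hr', hc'⟩ := h'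
  rw [hr] at hr'
  cases hr'
  exact eq_of_countP_take_eq hs (by simp [Action.IsSendOn]) hs' (by simp [Action.IsSendOn])
    (hc.trans hc'.symm)

theorem IsMatchingPair.right_unique {e : List Action} {i j j' : ℕ} (h : IsMatchingPair e i j)
    (h' : IsMatchingPair e i j') : j = j' := by
  obtain ⟨-, p, q, m, hs, hr, hc⟩ := h
  obtain ⟨-, p', q', m', hs', hr', hc'⟩ := h'
  rw [hs] at hs'
  cases hs'
  exact eq_of_countP_take_eq hr (by simp [Action.IsRecvOn]) hr' (by simp [Action.IsRecvOn])
    (hc.symm.trans hc')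

theorem IsMatchingPair.not_consecutive {e : List Action} {i j k : ℕ} (h : IsMatchingPair e i j)
    (h' : IsMatchingPair e j k) : False := by
  obtain ⟨-, p, q, m, -, hr, -⟩ := h
  obtain ⟨-, p', q', m', hs, -, -⟩ := h'
  rw [hr] at hs
  cases hs

/-- A matching pair is determined by either end, its two ends are of different kinds, and the
singletons are of yet other kinds: distinct interactions are disjoint. -/
theorem IsInteraction.eq_of_mem {e : List Action} {χ χ' : Finset ℕ} {j : ℕ}
    (h : IsInteraction e χ) (h' : IsInteraction e χ') (hj : j ∈ χ) (hj' : j ∈ χ') : χ = χ' := by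
  rcases h with ⟨a, b, hab, rfl⟩ | ⟨a, p, q, m, ha, hun, rfl⟩ | ⟨a, p, c, ha, rfl⟩ <;>
  rcases h' with ⟨a', b', hab', rfl⟩ | ⟨a', p', q', m', ha', hun', rfl⟩ | ⟨a', p', c', ha', rfl⟩ <;>
  simp only [Finset.mem_insert, Finset.mem_singleton] at hj hj'
  · rcases hj with rfl | rfl <;> rcases hj' with rfl | rfl
    · rw [hab.right_unique hab']
    · exact (hab'.not_consecutive hab).elim
    · exact (hab.not_consecutive hab').elim
    · rw [hab.left_unique hab']
  · subst hj'
    rcases hj with rfl | rfl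
    · exact absurd hab (hun' _)
    · obtain ⟨-, p, q, m, -, hr, -⟩ := hab
      rw [hr] at ha'; cases ha'
  · subst hj'
    obtain ⟨-, p, q, m, hs, hr, -⟩ := hab
    rcases hj with rfl | rfl
    · rw [hs] at ha'; cases ha'
    · rw [hr] at ha'; cases ha'
  · subst hj
    rcases hj' with rfl | rfl
    · exact absurd hab' (hun _)
    · obtain ⟨-, p, q, m, -, hr, -⟩ := hab'
      rw [hr] at ha; cases ha
  · rw [← hj, ← hj']
  · rw [← hj, ← hj']
  · subst hj
    obtain ⟨-, p, q, m, hs, hr, -⟩ := hab'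
    rcases hj' with rfl | rfl
    · rw [hs] at ha; cases ha
    · rw [hr] at ha; cases ha
  · rw [← hj, ← hj']
  · rw [← hj, ← hj']

theorem lt_length_of_getElem? {e : List Action} {j : ℕ} {a : Action} (h : e[j]? = some a) :
    j < e.length := (List.getElem?_eq_some_iff.1 h).1

theorem IsInteraction.lt_length {e : List Action} {χ : Finset ℕ} (h : IsInteraction e χ) {j : ℕ}
    (hj : j ∈ χ) : j < e.length := by
  rcases h with ⟨a, b, ⟨-, p, q, m, hs, hr, -⟩, rfl⟩ | ⟨a, p, q, m, ha, -, rfl⟩ | ⟨a, p, c, ha, rfl⟩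
  · rcases Finset.mem_insert.1 hj with rfl | hj
    · exact lt_length_of_getElem? hs
    · rw [Finset.mem_singleton.1 hj]; exact lt_length_of_getElem? hr
  · rw [Finset.mem_singleton.1 hj]; exact lt_length_of_getElem? ha
  · rw [Finset.mem_singleton.1 hj]; exact lt_length_of_getElem? ha

theorem IsInteraction.nonempty {e : List Action} {χ : Finset ℕ} (h : IsInteraction e χ) :
    χ.Nonempty := by
  rcases h with ⟨a, b, -, rfl⟩ | ⟨a, p, q, m, ha, -, rfl⟩ | ⟨a, p, c, ha, rfl⟩ <;> simp

theorem Matched.isCommunication {e : List Action} (h : Matched e) :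
    IsCommunication e {χ | IsInteraction e χ} := by
  refine ⟨fun χ hχ => hχ, fun j hj => ?_⟩
  have hex : ∃ χ, IsInteraction e χ ∧ j ∈ χ := by
    have hget := List.getElem?_eq_getElem hj
    rcases hej : e[j] with ⟨p, q, m⟩ | ⟨p, q, m⟩ | ⟨p, c⟩ <;> rw [hej] at hget
    · by_cases hm : ∃ j', IsMatchingPair e j j'
      · obtain ⟨j', hm⟩ := hm
        exact ⟨{j, j'}, Or.inl ⟨j, j', hm, rfl⟩, by simp⟩
      · exact ⟨{j}, Or.inr (Or.inl ⟨j, p, q, m, hget, not_exists.1 hm, rfl⟩), by simp⟩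
    · obtain ⟨i, hi⟩ := h _ _ _ _ hget
      exact ⟨{i, j}, Or.inl ⟨i, j, hi, rfl⟩, by simp⟩
    · exact ⟨{j}, Or.inr (Or.inr ⟨j, p, c, hget, rfl⟩), by simp⟩
  obtain ⟨χ, hχ, hjχ⟩ := hex
  exact ⟨χ, ⟨hχ, hjχ⟩, fun χ' h' => h'.1.eq_of_mem hχ h'.2 hjχ⟩

/-- Since distinct interactions are disjoint, covering every position forces all interactions to be
taken: an action sequence has at most one valid communication. -/
theorem IsCommunication.eq_setOf {e : List Action} {C : Set (Finset ℕ)} (h : IsCommunication e C) :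
    C = {χ | IsInteraction e χ} := by
  refine Set.Subset.antisymm h.1 fun χ hχ => ?_
  obtain ⟨j, hj⟩ := hχ.nonempty
  obtain ⟨χ', ⟨hC, hj'⟩, -⟩ := h.2 j (hχ.lt_length hj)
  rwa [hχ.eq_of_mem (h.1 _ hC) hj hj']

theorem pair_mem_iff_isMatchingPair {e : List Action} {i j : ℕ} (hij : i < j) :
    IsInteraction e {i, j} ↔ IsMatchingPair e i j := by
  refine ⟨fun h => ?_, fun h => Or.inl ⟨i, j, h, rfl⟩⟩
  have hsing : ∀ a : ℕ, ({i, j} : Finset ℕ) ≠ {a} := by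
    intro a ha
    have hi : i ∈ ({a} : Finset ℕ) := ha ▸ by simp
    have hj : j ∈ ({a} : Finset ℕ) := ha ▸ by simp
    rw [Finset.mem_singleton] at hi hj
    omega
  rcases h with ⟨a, b, hab, h⟩ | ⟨a, p, q, m, -, -, h⟩ | ⟨a, p, c, -, h⟩
  · have hi : i ∈ ({a, b} : Finset ℕ) := h ▸ by simp
    have hj : j ∈ ({a, b} : Finset ℕ) := h ▸ by simp
    simp only [Finset.mem_insert, Finset.mem_singleton] at hi hj
    have := hab.1
    obtain ⟨rfl, rfl⟩ : i = a ∧ j = b := by omega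
    exact hab
  · exact absurd h (hsing a)
  · exact absurd h (hsing a)

/-! ### Executions with the same projections are causally equivalent -/

/-- All sends on a channel are made by one process, and likewise all receives, so the numbering that
defines matching is visible in the projections. -/
theorem countP_send_proj (p q : ℕ) (e : List Action) :
    (proj p e).countP (fun a => Action.IsSendOn p q a) =
      e.countP (fun a => Action.IsSendOn p q a) := by
  rw [proj, List.countP_filter]
  refine List.countP_congr fun a _ => ?_
  simp only [Bool.and_eq_true, decide_eq_true_eq]
  rcases a with _ | _ | _ <;> simp +contextual [Action.IsSendOn, Action.proc]

theorem countP_recv_proj (p q : ℕ) (e : List Action) :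
    (proj q e).countP (fun a => Action.IsRecvOn p q a) =
      e.countP (fun a => Action.IsRecvOn p q a) := by
  rw [proj, List.countP_filter]
  refine List.countP_congr fun a _ => ?_
  simp only [Bool.and_eq_true, decide_eq_true_eq]
  rcases a with _ | _ | _ <;> simp +contextual [Action.IsRecvOn, Action.proc]

theorem length_proj_take_lt {e : List Action} {i j : ℕ} {a : Action} (hij : i < j)
    (ha : e[i]? = some a) : (proj a.proc (e.take i)).length < (proj a.proc (e.take j)).length := by
  have := countP_take_lt (P := fun b => decide (b.proc = a.proc)) hij ha (by simp)
  simpa [proj, List.countP_eq_length_filter] using this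

/-- The positions `j` of `e` and `j'` of `e'` carry the same action, and its process has done the
same things before. -/
def Corr (e e' : List Action) (j j' : ℕ) : Prop :=
  ∃ a, e[j]? = some a ∧ e'[j']? = some a ∧ proj a.proc (e.take j) = proj a.proc (e'.take j')

theorem Corr.symm {e e' : List Action} {j j' : ℕ} (h : Corr e e' j j') : Corr e' e j' j := by
  obtain ⟨a, h₁, h₂, h₃⟩ := h
  exact ⟨a, h₂, h₁, h₃.symm⟩

theorem Corr.getElem?_eq {e e' : List Action} {j j' : ℕ} (h : Corr e e' j j') :
    e'[j']? = e[j]? := by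
  obtain ⟨a, h₁, h₂, h₃⟩ := h
  rw [h₁, h₂]

/-- For actions of one process, the order of positions is the order of the lengths of the projected
prefixes, which a correspondence preserves. -/
theorem Corr.lt_of_lt {e e' : List Action} {i i' j j' : ℕ} (hi : Corr e e' i i')
    (hj : Corr e e' j j') (hp : (e[i]?).map Action.proc = (e[j]?).map Action.proc) (hij : i < j) :
    i' < j' := by
  obtain ⟨a, h₁, h₂, h₃⟩ := hi
  obtain ⟨b, h₄, h₅, h₆⟩ := hj
  rw [h₁, h₄] at hp
  have hab : a.proc = b.proc := by simpa using hp
  have hlt := length_proj_take_lt hij h₁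
  rw [h₃, hab, h₆] at hlt
  by_contra hle
  have := ((List.take_sublist_take_left (l := e') (not_lt.1 hle)).filter
    (fun c => decide (c.proc = b.proc))).length_le
  exact absurd hlt (not_lt.2 this)

theorem Corr.unique_left {e e' : List Action} {i j j' : ℕ} (hi : Corr e e' i j')
    (hj : Corr e e' j j') : i = j := by
  have hp : (e[i]?).map Action.proc = (e[j]?).map Action.proc := by
    rw [← hi.getElem?_eq, ← hj.getElem?_eq]
  rcases lt_trichotomy i j with h | h | h
  · exact absurd (hi.lt_of_lt hj hp h) (lt_irrefl _)
  · exact h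
  · exact absurd (hj.lt_of_lt hi hp.symm h) (lt_irrefl _)

/-- The action at `j` is a definite entry of the projection to its process; the partner is the
position in `e'` that produces the same entry. -/
theorem exists_corr {e e' : List Action} (h : ∀ k, proj k e = proj k e') {j : ℕ}
    (hj : j < e.length) : ∃ j', Corr e e' j j' := by
  have he : e = e.take j ++ e[j] :: e.drop (j + 1) := by
    rw [List.cons_getElem_drop_succ, List.take_append_drop]
  have hget := List.getElem?_eq_getElem hj
  generalize e[j] = a at he hget
  have hk := h a.proc
  rw [he, proj_append] at hk
  have hcons : proj a.proc (a :: e.drop (j + 1)) = a :: proj a.proc (e.drop (j + 1)) := by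
    simp [proj]
  obtain ⟨l₁, l₂, rfl, h₁, h₂⟩ := List.filter_eq_append_iff.1 hk.symm
  rw [← proj, hcons] at h₂
  obtain ⟨l₃, l₄, rfl, h₃, -, -⟩ := List.filter_eq_cons_iff.1 h₂
  refine ⟨(l₁ ++ l₃).length, a, hget, by simp, ?_⟩
  rw [← List.append_assoc, List.take_left, proj_append, ← h₁]
  have : proj a.proc l₃ = [] := List.filter_eq_nil_iff.2 h₃
  rw [this, List.append_nil]
  rfl

/-! ### Transport of the conflict graph along corresponding positions -/

section Iso

variable {e e' : List Action} {g : ℕ → ℕ}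

/-- The image of the receive has some matching send in `e'`. Its number on the channel is computed
from the projections, which agree, so it is the image of the original send. -/
theorem IsMatchingPair.map (he' : Matched e') (hg : ∀ j < e.length, Corr e e' j (g j)) {j j' : ℕ}
    (h : IsMatchingPair e j j') : IsMatchingPair e' (g j) (g j') := by
  obtain ⟨-, p, q, m, hs, hr, hc⟩ := h
  obtain ⟨a, ha, ha', hat⟩ := hg j (lt_length_of_getElem? hs)
  obtain ⟨b, hb, hb', hbt⟩ := hg j' (lt_length_of_getElem? hr)
  rw [hs] at ha; cases ha
  rw [hr] at hb; cases hb
  simp only [Action.proc] at hat hbt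
  obtain ⟨i, hi⟩ := he' _ _ _ _ hb'
  suffices i = g j by rwa [this] at hi
  obtain ⟨-, p', q', m', hs', hr', hc'⟩ := hi
  rw [hb'] at hr'; cases hr'
  refine eq_of_countP_take_eq hs' (P := fun a => decide (Action.IsSendOn p q a))
    (by simp [Action.IsSendOn]) ha' (by simp [Action.IsSendOn]) ?_
  rw [hc', ← countP_recv_proj, ← hbt, countP_recv_proj, ← hc, ← countP_send_proj, hat,
    countP_send_proj]

theorem IsInteraction.map {g' : ℕ → ℕ} (he : Matched e) (he' : Matched e')
    (hg : ∀ j < e.length, Corr e e' j (g j)) (hg' : ∀ j < e'.length, Corr e' e j (g' j))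
    {χ : Finset ℕ} (h : IsInteraction e χ) : IsInteraction e' (χ.image g) := by
  rcases h with ⟨a, b, hab, rfl⟩ | ⟨a, p, q, m, ha, hun, rfl⟩ | ⟨a, p, c, ha, rfl⟩
  · exact Or.inl ⟨g a, g b, hab.map he' hg, by simp [Finset.image_insert]⟩
  · have hga := hg a (lt_length_of_getElem? ha)
    -- A match of the image would be carried back by `g'` to a match of the original send.
    refine Or.inr (Or.inl ⟨g a, p, q, m, hga.getElem?_eq.trans ha, fun j' hj' => ?_, by simp⟩)
    have := hj'.map he hg'
    rw [(hg' (g a) (lt_length_of_getElem? (hga.getElem?_eq.trans ha))).symm.unique_left hga] at this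
    exact hun _ this
  · exact Or.inr (Or.inr ⟨g a, p, c,
      (hg a (lt_length_of_getElem? ha)).getElem?_eq.trans ha, by simp⟩)

theorem Prec.map (he' : Matched e') (hg : ∀ j < e.length, Corr e e' j (g j)) {j j' : ℕ}
    (h : Prec e {χ | IsInteraction e χ} j j') :
    Prec e' {χ | IsInteraction e' χ} (g j) (g j') := by
  obtain ⟨hlt, hlen, h⟩ := h
  have hj := hg j (hlt.trans hlen)
  have hj' := hg j' hlen
  have hlen' : g j' < e'.length := by
    obtain ⟨a, -, ha, -⟩ := hj'
    exact lt_length_of_getElem? ha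
  simp only [ActionsCommute, Set.mem_ofPred_eq, not_and_or, not_not, ne_eq] at h
  simp only [Prec, ActionsCommute, Set.mem_ofPred_eq, not_and_or, not_not, ne_eq]
  rcases h with h | h
  · exact ⟨hj.lt_of_lt hj' h hlt, hlen', Or.inl (by rw [hj.getElem?_eq, hj'.getElem?_eq, h])⟩
  · have := ((pair_mem_iff_isMatchingPair hlt).1 h).map he' hg
    exact ⟨this.1, hlen', Or.inr ((pair_mem_iff_isMatchingPair this.1).2 this)⟩

theorem causallyEquivalent_of_proj_eq (he : Matched e) (he' : Matched e')
    (h : ∀ k, proj k e = proj k e') :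
    CausallyEquivalent e {χ | IsInteraction e χ} e' {χ | IsInteraction e' χ} := by
  -- The value 0 past the end only makes the choice total; `g` is used on positions of `e` alone.
  have hex : ∀ j, ∃ j', j < e.length → Corr e e' j j' := fun j => by
    by_cases hj : j < e.length
    · obtain ⟨j', hj'⟩ := exists_corr h hj
      exact ⟨j', fun _ => hj'⟩
    · exact ⟨0, fun h => absurd h hj⟩
  have hex' : ∀ j, ∃ j', j < e'.length → Corr e' e j j' := fun j => by
    by_cases hj : j < e'.length
    · obtain ⟨j', hj'⟩ := exists_corr (fun k => (h k).symm) hj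
      exact ⟨j', fun _ => hj'⟩
    · exact ⟨0, fun h => absurd h hj⟩
  choose g hg using hex
  choose g' hg' using hex'
  have hlen : ∀ j < e.length, g j < e'.length := fun j hj => by
    obtain ⟨a, -, ha, -⟩ := hg j hj
    exact lt_length_of_getElem? ha
  have hlen' : ∀ j < e'.length, g' j < e.length := fun j hj => by
    obtain ⟨a, -, ha, -⟩ := hg' j hj
    exact lt_length_of_getElem? ha
  have hinv : ∀ j < e.length, g' (g j) = j := fun j hj =>
    (hg' (g j) (hlen j hj)).symm.unique_left (hg j hj)
  have hinv' : ∀ j < e'.length, g (g' j) = j := fun j hj =>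
    (hg (g' j) (hlen' j hj)).symm.unique_left (hg' j hj)
  have himage : ∀ χ, IsInteraction e χ → (χ.image g).image g' = χ := fun χ hχ => by
    rw [Finset.image_image]
    conv_rhs => rw [← Finset.image_id (s := χ)]
    exact Finset.image_congr fun j hj => hinv j (hχ.lt_length hj)
  have himage' : ∀ χ, IsInteraction e' χ → (χ.image g').image g = χ := fun χ hχ => by
    rw [Finset.image_image]
    conv_rhs => rw [← Finset.image_id (s := χ)]
    exact Finset.image_congr fun j hj => hinv' j (hχ.lt_length hj)
  refine ⟨⟨⟨fun χ => ⟨χ.1.image g, χ.2.map he he' hg hg'⟩,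
    fun χ => ⟨χ.1.image g', χ.2.map he' he hg' hg⟩, fun χ => Subtype.ext (himage _ χ.2),
    fun χ => Subtype.ext (himage' _ χ.2)⟩, ?_⟩, ?_⟩
  · intro χ₁ χ₂
    constructor
    · rintro ⟨j₁, h₁, j₂, h₂, hp⟩
      refine ⟨g' j₁, ?_, g' j₂, ?_, hp.map he hg'⟩
      · rw [← himage _ χ₁.2]; exact Finset.mem_image_of_mem _ h₁
      · rw [← himage _ χ₂.2]; exact Finset.mem_image_of_mem _ h₂
    · rintro ⟨j₁, h₁, j₂, h₂, hp⟩
      exact ⟨g j₁, Finset.mem_image_of_mem _ h₁, g j₂, Finset.mem_image_of_mem _ h₂,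
        hp.map he' hg⟩
  · intro χ
    have hinj : Set.InjOn g χ.1 := fun i hi j hj hij => by
      rw [← hinv i (χ.2.lt_length hi), ← hinv j (χ.2.lt_length hj), hij]
    change Multiset.map _ _ = Multiset.map _ (χ.1.image g).val
    rw [Finset.image_val_of_injOn hinj, Multiset.map_map]
    exact Multiset.map_congr rfl fun j hj => ((hg j (χ.2.lt_length hj)).getElem?_eq).symm

end Iso

/-! ### Messages sent and received -/

/-- The messages sent on the channel `(p, q)`. -/
def sendMsgs (p q : ℕ) (e : List Action) : List Msg :=
  e.filterMap fun
    | Action.send p' q' m => if p' = p ∧ q' = q then some m else none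
    | _ => none

/-- The messages received on the channel `(p, q)`. -/
def recvMsgs (p q : ℕ) (e : List Action) : List Msg :=
  e.filterMap fun
    | Action.recv p' q' m => if p' = p ∧ q' = q then some m else none
    | _ => none

/-- The messages that are sent on the channel `(p, q)` and never received. -/
def loneMsgs (p q : ℕ) (l : List Move) : List Msg :=
  l.filterMap fun
    | Move.lone p' q' m => if p' = p ∧ q' = q then some m else none
    | _ => none

@[simp] theorem sendMsgs_append (p q : ℕ) (e e' : List Action) :
    sendMsgs p q (e ++ e') = sendMsgs p q e ++ sendMsgs p q e' := List.filterMap_append ..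

@[simp] theorem recvMsgs_append (p q : ℕ) (e e' : List Action) :
    recvMsgs p q (e ++ e') = recvMsgs p q e ++ recvMsgs p q e' := List.filterMap_append ..

@[simp] theorem loneMsgs_append (p q : ℕ) (l l' : List Move) :
    loneMsgs p q (l ++ l') = loneMsgs p q l ++ loneMsgs p q l' := List.filterMap_append ..

theorem length_sendMsgs (p q : ℕ) (e : List Action) :
    (sendMsgs p q e).length = e.countP (fun a => Action.IsSendOn p q a) := by
  induction e with
  | nil => rfl
  | cons a e ih =>
    rw [List.countP_cons, ← ih, sendMsgs, List.filterMap_cons]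
    rcases a with ⟨p', q', m⟩ | ⟨p', q', m⟩ | ⟨p', c⟩
    · by_cases h : p' = p ∧ q' = q <;> simp [h, Action.IsSendOn, sendMsgs]
    · simp only [Action.IsSendOn, sendMsgs, decide_eq_false id]
      rfl
    · simp only [Action.IsSendOn, sendMsgs, decide_eq_false id]
      rfl

theorem length_recvMsgs (p q : ℕ) (e : List Action) :
    (recvMsgs p q e).length = e.countP (fun a => Action.IsRecvOn p q a) := by
  induction e with
  | nil => rfl
  | cons a e ih =>
    rw [List.countP_cons, ← ih, recvMsgs, List.filterMap_cons]
    rcases a with ⟨p', q', m⟩ | ⟨p', q', m⟩ | ⟨p', c⟩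
    · simp only [Action.IsRecvOn, recvMsgs, decide_eq_false id]
      rfl
    · by_cases h : p' = p ∧ q' = q <;> simp [h, Action.IsRecvOn, recvMsgs]
    · simp only [Action.IsRecvOn, recvMsgs, decide_eq_false id]
      rfl

theorem sendMsgs_proj (p q : ℕ) (e : List Action) : sendMsgs p q (proj p e) = sendMsgs p q e := by
  induction e with
  | nil => rfl
  | cons a e ih =>
    rw [← List.singleton_append, proj_append, sendMsgs_append, sendMsgs_append, ih]
    congr 1
    by_cases h : a.proc = p
    · subst h; rw [proj_singleton_self]
    · rw [proj_singleton_of_ne h]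
      rcases a with _ | _ | _ <;> simp_all [sendMsgs, Action.proc]

theorem recvMsgs_proj (p q : ℕ) (e : List Action) : recvMsgs p q (proj q e) = recvMsgs p q e := by
  induction e with
  | nil => rfl
  | cons a e ih =>
    rw [← List.singleton_append, proj_append, recvMsgs_append, recvMsgs_append, ih]
    congr 1
    by_cases h : a.proc = q
    · subst h; rw [proj_singleton_self]
    · rw [proj_singleton_of_ne h]
      rcases a with _ | _ | _ <;> simp_all [recvMsgs, Action.proc]

theorem loneMsgs_eq_nil_iff {p q : ℕ} {l : List Move} : loneMsgs p q l = [] ↔ ¬ HasLone p q l := by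
  rw [loneMsgs, List.filterMap_eq_nil_iff]
  constructor
  · rintro h ⟨m, hm⟩
    simpa using h _ hm
  · intro h x hx
    rcases x with _ | ⟨p', q', m⟩ | _
    · rfl
    · simp only [ite_eq_right_iff, reduceCtorEq, imp_false]
      rintro ⟨rfl, rfl⟩
      exact h ⟨m, hx⟩
    · rfl

theorem exists_of_loneMsgs_eq_cons {p q : ℕ} {l : List Move} {m : Msg} {w : List Msg}
    (h : loneMsgs p q l = m :: w) :
    ∃ l₁ l₂, l = l₁ ++ Move.lone p q m :: l₂ ∧ ¬ HasLone p q l₁ := by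
  obtain ⟨l₁, x, l₂, rfl, h₁, hx, -⟩ := List.filterMap_eq_cons_iff.1 h
  have h₁' : ¬ HasLone p q l₁ := loneMsgs_eq_nil_iff.1 (List.filterMap_eq_nil_iff.2 h₁)
  rcases x with _ | ⟨p', q', m'⟩ | _
  · simp at hx
  · by_cases hc : p' = p ∧ q' = q
    · obtain ⟨rfl, rfl⟩ := hc
      obtain rfl : m' = m := by simpa using hx
      exact ⟨l₁, l₂, rfl, h₁'⟩
    · simp [hc] at hx
  · simp at hx

theorem exists_of_sendMsgs_eq_append {p q : ℕ} {e : List Action} {m : Msg} {u w : List Msg}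
    (h : sendMsgs p q e = u ++ m :: w) :
    ∃ e₁ e₂, e = e₁ ++ Action.send p q m :: e₂ ∧ sendMsgs p q e₁ = u := by
  obtain ⟨e₁, e₂, rfl, h₁, h₂⟩ := List.filterMap_eq_append_iff.1 h
  obtain ⟨e₃, x, e₄, rfl, h₃, hx, -⟩ := List.filterMap_eq_cons_iff.1 h₂
  have h₃' : sendMsgs p q e₃ = [] := List.filterMap_eq_nil_iff.2 h₃
  rcases x with ⟨p', q', m'⟩ | _ | _
  · by_cases hc : p' = p ∧ q' = q
    · obtain ⟨rfl, rfl⟩ := hc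
      obtain rfl : m' = m := by simpa using hx
      refine ⟨e₁ ++ e₃, e₄, by simp, ?_⟩
      rw [sendMsgs_append, h₃', List.append_nil]
      exact h₁
    · simp [hc] at hx
  · simp at hx
  · simp at hx

theorem getElem?_concat_eq_some {e : List Action} {a b : Action} {j : ℕ}
    (h : (e ++ [a])[j]? = some b) : e[j]? = some b ∨ (j = e.length ∧ a = b) := by
  rcases lt_trichotomy j e.length with hj | hj | hj
  · rw [List.getElem?_append_left hj] at h; exact Or.inl h
  · subst hj; simp at h; exact Or.inr ⟨rfl, h⟩
  · rw [List.getElem?_eq_none (by simp; omega)] at h; cases h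

theorem IsMatchingPair.append {e : List Action} {i j : ℕ} (h : IsMatchingPair e i j)
    (e' : List Action) : IsMatchingPair (e ++ e') i j := by
  obtain ⟨hlt, p, q, m, hs, hr, hc⟩ := h
  have hi := lt_length_of_getElem? hs
  have hj := lt_length_of_getElem? hr
  refine ⟨hlt, p, q, m, ?_, ?_, ?_⟩
  · rwa [List.getElem?_append_left hi]
  · rwa [List.getElem?_append_left hj]
  · rwa [List.take_append_of_le_length hi.le, List.take_append_of_le_length hj.le]

/-- The hypothesis says that as many messages were sent before this send as were received before the
new receive, so both carry the same number. -/
theorem isMatchingPair_concat_recv {e₁ e₂ : List Action} {p q : ℕ} {m : Msg}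
    (h : sendMsgs p q e₁ = recvMsgs p q (e₁ ++ Action.send p q m :: e₂)) :
    IsMatchingPair (e₁ ++ Action.send p q m :: e₂ ++ [Action.recv p q m]) e₁.length
      (e₁ ++ Action.send p q m :: e₂).length := by
  refine ⟨by simp, p, q, m, by simp, by simp, ?_⟩
  rw [List.take_left' rfl, List.append_assoc, List.take_left' rfl, ← length_sendMsgs,
    ← length_recvMsgs, h]

theorem Matched.concat {e : List Action} (he : Matched e) {a : Action}
    (ha : ∀ p q m, a = Action.recv p q m →
      ∃ w, sendMsgs p q e = recvMsgs p q e ++ m :: w) : Matched (e ++ [a]) := by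
  intro j' p q m hj'
  rcases getElem?_concat_eq_some hj' with hj' | ⟨rfl, rfl⟩
  · obtain ⟨j, hj⟩ := he _ _ _ _ hj'
    exact ⟨j, hj.append _⟩
  · obtain ⟨w, hw⟩ := ha p q m rfl
    obtain ⟨e₁, e₂, rfl, h⟩ := exists_of_sendMsgs_eq_append hw
    exact ⟨_, isMatchingPair_concat_recv h⟩

/-! ### The executions described by ordered lists of moves -/

/-- A communication is appended only when nothing waits on its channel, so its message comes right
after those already received; the waiting ones form the tail. -/
theorem sendMsgs_flat {l : List Move} (hl : Ordered l) (p q : ℕ) :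
    sendMsgs p q (flat l) = recvMsgs p q (flat l) ++ loneMsgs p q l := by
  induction l using List.reverseRecOn with
  | nil => rfl
  | append_singleton l x ih =>
    rw [flat_append, sendMsgs_append, recvMsgs_append, loneMsgs_append]
    rcases x with ⟨p', q', m⟩ | ⟨p', q', m⟩ | ⟨p', c⟩
    · rw [ordered_concat_sync] at hl
      rw [ih hl.1]
      by_cases hc : p' = p ∧ q' = q
      · obtain ⟨rfl, rfl⟩ := hc
        rw [loneMsgs_eq_nil_iff.2 hl.2]
        simp [sendMsgs, recvMsgs, loneMsgs, Move.acts]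
      · simp [sendMsgs, recvMsgs, loneMsgs, Move.acts, hc]
    · rw [ih (ordered_concat_lone.1 hl)]
      by_cases hc : p' = p ∧ q' = q <;> simp [sendMsgs, recvMsgs, loneMsgs, Move.acts, hc]
    · rw [ih (ordered_concat_inner.1 hl)]
      simp [sendMsgs, recvMsgs, loneMsgs, Move.acts]

theorem isMatchingPair_flat {l : List Move} (hl : Ordered l) {j' p q : ℕ} {m : Msg}
    (hj' : (flat l)[j']? = some (Action.recv p q m)) :
    ∃ j, j' = j + 1 ∧ IsMatchingPair (flat l) j j' := by
  induction l using List.reverseRecOn with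
  | nil => simp at hj'
  | append_singleton l x ih =>
    rw [flat_append, flat_cons, flat_nil, List.append_nil] at hj' ⊢
    rcases x with ⟨p', q', m'⟩ | ⟨p', q', m'⟩ | ⟨p', c⟩
    · rw [ordered_concat_sync] at hl
      rw [Move.acts, ← List.singleton_append, ← List.append_assoc] at hj' ⊢
      rcases getElem?_concat_eq_some hj' with hj' | ⟨rfl, h⟩
      · rcases getElem?_concat_eq_some hj' with hj' | ⟨rfl, h⟩
        · obtain ⟨j, rfl, hj⟩ := ih hl.1 hj'
          exact ⟨j, rfl, (hj.append _).append _⟩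
        · cases h
      · cases h
        refine ⟨(flat l).length, by simp, isMatchingPair_concat_recv ?_⟩
        rw [sendMsgs_flat hl.1, loneMsgs_eq_nil_iff.2 hl.2]
        simp [recvMsgs]
    · rcases getElem?_concat_eq_some hj' with hj' | ⟨rfl, h⟩
      · obtain ⟨j, rfl, hj⟩ := ih (ordered_concat_lone.1 hl) hj'
        exact ⟨j, rfl, hj.append _⟩
      · cases h
    · rcases getElem?_concat_eq_some hj' with hj' | ⟨rfl, h⟩
      · obtain ⟨j, rfl, hj⟩ := ih (ordered_concat_inner.1 hl) hj'
        exact ⟨j, rfl, hj.append _⟩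
      · cases h

theorem matched_flat {l : List Move} (hl : Ordered l) : Matched (flat l) := fun _ _ _ _ h =>
  (isMatchingPair_flat hl h).imp fun _ h => h.2

theorem isRSCExecution_flat {l : List Move} (hl : Ordered l) (C : Set (Finset ℕ)) :
    IsRSCExecution (flat l) C := by
  intro j j' h _
  obtain ⟨-, p, q, m, -, hr, -⟩ := id h
  obtain ⟨i, rfl, hi⟩ := isMatchingPair_flat hl hr
  rw [h.left_unique hi]

/-! ### Executions of the system -/

namespace FIFOSystem

variable {S : FIFOSystem}

theorem Run.concat {γ γ₁ γ₂ : Config} {e : List Action} {a : Action} (h : S.Run γ e γ₁)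
    (ha : S.Step γ₁ a γ₂) : S.Run γ (e ++ [a]) γ₂ := by
  induction h with
  | nil γ => exact .cons ha (.nil _)
  | cons h _ ih => exact .cons h (ih ha)

theorem Run.exists_of_concat {γ γ₂ : Config} {e : List Action} {a : Action}
    (h : S.Run γ (e ++ [a]) γ₂) : ∃ γ₁, S.Run γ e γ₁ ∧ S.Step γ₁ a γ₂ := by
  induction e generalizing γ with
  | nil =>
    rcases h with _ | ⟨h, t⟩
    rcases t with _ | _
    exact ⟨γ, .nil _, h⟩
  | cons b e ih =>
    rcases h with _ | ⟨h, t⟩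
    obtain ⟨γ₁, h₁, h₂⟩ := ih t
    exact ⟨γ₁, .cons h h₁, h₂⟩

theorem run_nil_iff {γ γ' : Config} : S.Run γ [] γ' ↔ γ' = γ := by
  constructor
  · rintro ⟨⟩; rfl
  · rintro rfl; exact .nil _

theorem Run.localRun {e : List Action} {γ : Config} (h : S.Run S.initConfig e γ) :
    S.LocalRun e γ.state := by
  induction e using List.reverseRecOn generalizing γ with
  | nil =>
    rw [run_nil_iff] at h
    subst h
    exact localRun_nil_iff.2 rfl
  | append_singleton e a ih =>
    obtain ⟨γ₁, h₁, ha⟩ := h.exists_of_concat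
    rw [localRun_concat_iff]
    cases ha with
    | send p q m s h' => exact ⟨_, s, ih h₁, h', rfl⟩
    | recv p q m s w h' hw => exact ⟨_, s, ih h₁, h', rfl⟩
    | internal p c s h' => exact ⟨_, s, ih h₁, h', rfl⟩

/-- The FIFO invariant: a channel holds what was sent on it minus the prefix already received. -/
theorem Run.sendMsgs_eq {e : List Action} {γ : Config} (h : S.Run S.initConfig e γ) (p q : ℕ) :
    sendMsgs p q e = recvMsgs p q e ++ γ.chan (p, q) := by
  induction e using List.reverseRecOn generalizing γ with
  | nil =>
    rw [run_nil_iff] at h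
    subst h
    rfl
  | append_singleton e a ih =>
    obtain ⟨γ₁, h₁, ha⟩ := h.exists_of_concat
    rw [sendMsgs_append, recvMsgs_append, ih h₁]
    cases ha with
    | send p' q' m s h' =>
      by_cases hc : p' = p ∧ q' = q
      · obtain ⟨rfl, rfl⟩ := hc
        simp [sendMsgs, recvMsgs]
      · have : (p, q) ≠ (p', q') := fun h => hc (by simpa [eq_comm] using h)
        simp [sendMsgs, recvMsgs, hc, Function.update_of_ne this]
    | recv p' q' m s w h' hw =>
      by_cases hc : p' = p ∧ q' = q
      · obtain ⟨rfl, rfl⟩ := hc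
        simp [sendMsgs, recvMsgs, hw]
      · have : (p, q) ≠ (p', q') := fun h => hc (by simpa [eq_comm] using h)
        simp [sendMsgs, recvMsgs, hc, Function.update_of_ne this]
    | internal p' c s h' => simp [sendMsgs, recvMsgs]

theorem Run.matched {e : List Action} {γ : Config} (h : S.Run S.initConfig e γ) : Matched e := by
  induction e using List.reverseRecOn generalizing γ with
  | nil => intro j' p q m h; simp at h
  | append_singleton e a ih =>
    obtain ⟨γ₁, h₁, ha⟩ := h.exists_of_concat
    refine (ih h₁).concat fun p q m hm => ?_
    subst hm
    cases ha with
    | recv _ _ _ s w h' hw => exact ⟨w, by rw [h₁.sendMsgs_eq, hw]⟩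

/-- For ordered moves the channels impose no further constraint: each receive finds its message
alone on the channel, and the unreceived messages are the final contents. -/
theorem LocalRun.run_flat {l : List Move} {σ : ℕ → ℕ} (hl : Ordered l)
    (hσ : S.LocalRun (flat l) σ) :
    S.Run S.initConfig (flat l) ⟨σ, fun c => loneMsgs c.1 c.2 l⟩ := by
  induction l using List.reverseRecOn generalizing σ with
  | nil =>
    rw [flat_nil, localRun_nil_iff] at hσ
    subst hσ
    exact .nil _
  | append_singleton l x ih =>
    rw [flat_append, flat_cons, flat_nil, List.append_nil] at hσ ⊢
    rcases x with ⟨p, q, m⟩ | ⟨p, q, m⟩ | ⟨p, c⟩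
    · rw [ordered_concat_sync] at hl
      rw [Move.acts, ← List.singleton_append, ← List.append_assoc] at hσ ⊢
      obtain ⟨_, r', hσ', ht', rfl⟩ := localRun_concat_iff.1 hσ
      obtain ⟨σ, s', hσ₁, ht, rfl⟩ := localRun_concat_iff.1 hσ'
      have hw := loneMsgs_eq_nil_iff.2 hl.2
      have hch : (fun c : ℕ × ℕ => loneMsgs c.1 c.2 (l ++ [Move.sync p q m])) =
          Function.update (Function.update (fun c : ℕ × ℕ => loneMsgs c.1 c.2 l) (p, q)
            (loneMsgs p q l ++ [m])) (p, q) [] := by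
        funext ⟨p', q'⟩
        have hx : loneMsgs p' q' [Move.sync p q m] = [] := rfl
        rw [Function.update_idem, loneMsgs_append, hx, List.append_nil]
        by_cases hc : (p', q') = (p, q)
        · obtain ⟨rfl, rfl⟩ := Prod.mk.inj hc
          rw [Function.update_self, hw]
        · rw [Function.update_of_ne hc]
      rw [hch]
      exact ((ih hl.1 hσ₁).concat (.send _ p q m s' ht)).concat
        (.recv _ p q m r' [] ht' (by simp [hw]))
    · rw [Move.acts] at hσ ⊢
      obtain ⟨σ, s', hσ₁, ht, rfl⟩ := localRun_concat_iff.1 hσ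
      have hch : (fun c : ℕ × ℕ => loneMsgs c.1 c.2 (l ++ [Move.lone p q m])) =
          Function.update (fun c : ℕ × ℕ => loneMsgs c.1 c.2 l) (p, q)
            (loneMsgs p q l ++ [m]) := by
        funext ⟨p', q'⟩
        by_cases hc : (p', q') = (p, q)
        · obtain ⟨rfl, rfl⟩ := Prod.mk.inj hc
          simp [loneMsgs]
        · have : ¬ (p = p' ∧ q = q') := fun h => hc (by simp [h])
          simp [Function.update_of_ne hc, loneMsgs, this]
      rw [hch]
      exact (ih (ordered_concat_lone.1 hl) hσ₁).concat (.send _ p q m s' ht)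
    · rw [Move.acts] at hσ ⊢
      obtain ⟨σ, s', hσ₁, ht, rfl⟩ := localRun_concat_iff.1 hσ
      have hch : (fun c' : ℕ × ℕ => loneMsgs c'.1 c'.2 (l ++ [Move.inner p c])) =
          fun c' : ℕ × ℕ => loneMsgs c'.1 c'.2 l := by
        funext c'
        simp [loneMsgs]
      rw [hch]
      exact (ih (ordered_concat_inner.1 hl) hσ₁).concat (.internal _ p c s' ht)

end FIFOSystem

/-! ### Systems without borderline executions are RSC -/

/-- The processes that take part in a move. -/
def Move.procs : Move → Set ℕ
  | sync p q _ => {p, q}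
  | lone p _ _ => {p}
  | inner p _ => {p}

theorem proj_acts_eq_nil {x : Move} {k : ℕ} (h : k ∉ x.procs) : proj k x.acts = [] := by
  rcases x with ⟨p, q, m⟩ | ⟨p, q, m⟩ | ⟨p, c⟩ <;>
    simp_all [Move.procs, Move.acts, proj, Action.proc, eq_comm]

theorem proj_flat_eq_nil {l : List Move} {k : ℕ} (h : ∀ x ∈ l, k ∉ x.procs) :
    proj k (flat l) = [] := by
  induction l with
  | nil => rfl
  | cons x l ih =>
    rw [flat_cons, proj_append, proj_acts_eq_nil (h x (by simp)),
      ih fun y hy => h y (by simp [hy])]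
    rfl

theorem Move.before_of_disjoint {x y : Move} (h : Disjoint x.procs y.procs) : x.Before y := by
  rcases x with _ | ⟨p, q, m⟩ | _ <;> rcases y with ⟨p', q', m'⟩ | _ | _ <;> try trivial
  rintro ⟨rfl, rfl⟩
  exact Set.disjoint_left.1 h rfl (Or.inl rfl)

theorem Move.spread_eq_self {x : Move} {K : Set ℕ} (h : Disjoint x.procs K) : x.spread K = K := by
  rcases x with ⟨p, q, m⟩ | _ | _ <;> try rfl
  have hp : p ∉ K := Set.disjoint_left.1 h (Or.inl rfl)
  have hq : q ∉ K := Set.disjoint_left.1 h (Or.inr rfl)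
  ext k
  simp [Move.spread, hp, hq]

theorem Move.procs_subset_spread {x : Move} {K : Set ℕ} (h : ¬ Disjoint x.procs K) :
    x.procs ⊆ x.spread K := by
  obtain ⟨k, hk, hkK⟩ := Set.not_disjoint_iff.1 h
  rcases x with ⟨p, q, m⟩ | ⟨p, q, m⟩ | ⟨p, c⟩
  · rintro k' (rfl | rfl) <;> rcases hk with rfl | rfl
    · exact Or.inl hkK
    · exact Or.inr (Or.inr ⟨rfl, hkK⟩)
    · exact Or.inr (Or.inl ⟨rfl, hkK⟩)
    · exact Or.inl hkK
  · rintro k' rfl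
    obtain rfl := hk
    exact hkK
  · rintro k' rfl
    obtain rfl := hk
    exact hkK

theorem Move.subset_spread (x : Move) (K : Set ℕ) : K ⊆ x.spread K :=
  CrashFIFO.subset_spread K [x]

/-- The moves of `l` that are not causally after `D` can be done before `D`. -/
theorem exists_split (l : List Move) {D : List Move} {K : Set ℕ} {q : ℕ}
    (hD : ∀ x ∈ D, x.procs ⊆ K) (hq : q ∉ spread K l) :
    ∃ l₁ l₂, (∀ x ∈ l₁, Disjoint x.procs K) ∧ (∀ x ∈ l₂, q ∉ x.procs) ∧
      (D ++ l).Perm (l₁ ++ (D ++ l₂)) ∧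
      (∀ k, proj k (flat (D ++ l)) = proj k (flat (l₁ ++ (D ++ l₂)))) ∧
      (Ordered (D ++ l) → Ordered (l₁ ++ (D ++ l₂))) := by
  induction l generalizing D K with
  | nil => exact ⟨[], [], by simp, by simp, .rfl, fun _ => rfl, id⟩
  | cons x l ih =>
    have hq' : q ∉ spread (x.spread K) l := hq
    -- A move disjoint from the processes causally after `D` jumps over `D` entirely; any other move
    -- joins `D`, and its processes join `K`.
    by_cases hx : Disjoint x.procs K
    · rw [Move.spread_eq_self hx] at hq'
      obtain ⟨l₁, l₂, h₁, h₂, hperm, hproj, hord⟩ := ih hD hq'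
      have hperm' : (D ++ x :: l).Perm (x :: l₁ ++ (D ++ l₂)) :=
        List.perm_middle.trans (hperm.cons x)
      refine ⟨x :: l₁, l₂, ?_, h₂, hperm', fun k => ?_, fun h => ?_⟩
      · intro y hy
        rcases List.mem_cons.1 hy with rfl | hy
        · exact hx
        · exact h₁ y hy
      · rw [List.cons_append, flat_cons, proj_append, ← hproj, flat_append, flat_cons, flat_append,
          proj_append, proj_append, proj_append]
        by_cases hk : k ∈ x.procs
        · rw [proj_flat_eq_nil (l := D)
            fun y hy hky => Set.disjoint_left.1 hx hk (hD y hy hky)]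
          rfl
        · rw [proj_acts_eq_nil hk]
          rfl
      · obtain ⟨hoD, hoxl, hDxl⟩ := List.pairwise_append.1 h
        obtain ⟨hxl, hol⟩ := List.pairwise_cons.1 hoxl
        refine List.pairwise_cons.2 ⟨fun y hy => ?_, hord (List.pairwise_append.2
          ⟨hoD, hol, fun a ha b hb => hDxl a ha b (by simp [hb])⟩)⟩
        rcases List.mem_append.1 (hperm.mem_iff.2 hy) with hy | hy
        · exact Move.before_of_disjoint (hx.mono_right (hD y hy))
        · exact hxl y hy
    · have hxK := Move.procs_subset_spread hx
      obtain ⟨l₁, l₂, h₁, h₂, hperm, hproj, hord⟩ := ih (D := D ++ [x]) (K := x.spread K)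
        (by
          intro y hy
          rcases List.mem_append.1 hy with hy | hy
          · exact (hD y hy).trans (x.subset_spread K)
          · rw [List.mem_singleton.1 hy]; exact hxK) hq'
      simp only [List.append_assoc, List.singleton_append] at hperm hproj hord
      refine ⟨l₁, x :: l₂, fun y hy => (h₁ y hy).mono_right (x.subset_spread K), ?_, hperm, hproj,
        hord⟩
      intro y hy
      rcases List.mem_cons.1 hy with rfl | hy
      · exact fun h => hq' (CrashFIFO.subset_spread _ _ (hxK h))
      · exact h₂ y hy

namespace FIFOSystem

variable {S : FIFOSystem}

/-- Sends and internal actions are appended as moves of their own. A receive is fused with its send,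
after the moves between them have been sorted by causal dependence on that send. -/
theorem Run.exists_ordered (hS : ¬ S.Borderline) {e : List Action} {γ : Config}
    (h : S.Run S.initConfig e γ) : ∃ l, Ordered l ∧ ∀ k, proj k e = proj k (flat l) := by
  induction e using List.reverseRecOn generalizing γ with
  | nil => exact ⟨[], .nil, fun _ => rfl⟩
  | append_singleton e a ih =>
    obtain ⟨γ₁, h₁, ha⟩ := h.exists_of_concat
    obtain ⟨l, hl, hproj⟩ := ih h₁
    cases ha with
    | send p q m s h' =>
      exact ⟨l ++ [Move.lone p q m], ordered_concat_lone.2 hl, fun k => by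
        rw [proj_append, hproj, flat_append, proj_append]; rfl⟩
    | internal p c s h' =>
      exact ⟨l ++ [Move.inner p c], ordered_concat_inner.2 hl, fun k => by
        rw [proj_append, hproj, flat_append, proj_append]; rfl⟩
    | recv p q m s w h' hw =>
      -- Sent and received words depend only on the projections, so the unreceived messages of `l`
      -- are the actual channel contents.
      have hlone : loneMsgs p q l = m :: w := by
        have h₂ := h₁.sendMsgs_eq p q
        rw [hw, ← sendMsgs_proj, ← recvMsgs_proj, hproj, hproj, sendMsgs_proj, recvMsgs_proj,
          sendMsgs_flat hl] at h₂
        exact List.append_cancel_left h₂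
      obtain ⟨l₁, l₂, rfl, hl₁⟩ := exists_of_loneMsgs_eq_cons hlone
      have hq : q ∉ spread {p} l₂ := fun hq => hS ⟨_, γ₁.state, p, q, m, s, hl,
        h₁.localRun.congr hproj, ⟨l₁, l₂, rfl, hl₁, hq⟩, h'⟩
      obtain ⟨l₃, l₄, h₃, h₄, hperm, hproj', hord⟩ :=
        exists_split l₂ (D := [Move.lone p q m]) (by simp [Move.procs]) hq
      obtain ⟨ho₁, ho₂, ho⟩ := List.pairwise_append.1 hl
      obtain ⟨ho₃, ho₄, ho₃₄⟩ := List.pairwise_append.1 (hord ho₂)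
      obtain ⟨-, ho₄⟩ := List.pairwise_cons.1 ho₄
      have hbefore : ∀ x, ¬ (∃ m, x = Move.lone p q m) → x.Before (Move.sync p q m) := by
        rintro (_ | ⟨p', q', m'⟩ | _) hx
        · trivial
        · rintro ⟨rfl, rfl⟩; exact hx ⟨m', rfl⟩
        · trivial
      -- `l₃` is independent of the send and goes before it; `l₄` does not involve `q`, so the
      -- receive may precede it.
      refine ⟨l₁ ++ (l₃ ++ ([Move.sync p q m] ++ l₄)), ?_, fun k => ?_⟩
      · refine List.pairwise_append.2 ⟨ho₁, List.pairwise_append.2 ⟨ho₃, List.pairwise_cons.2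
          ⟨fun y _ => by cases y <;> trivial, ho₄⟩, ?_⟩, ?_⟩
        -- No move of `l₃` involves `p`, so none leaves a message on the channel `(p, q)`.
        · intro x hx y hy
          rcases List.mem_cons.1 hy with rfl | hy
          · refine hbefore x ?_
            rintro ⟨m', rfl⟩
            exact Set.disjoint_left.1 (h₃ _ hx) rfl rfl
          · exact ho₃₄ x hx y (List.mem_cons_of_mem _ hy)
        · intro x hx y hy
          by_cases hy' : y = Move.sync p q m
          · subst hy'
            refine hbefore x ?_
            rintro ⟨m', rfl⟩
            exact hl₁ ⟨m', hx⟩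
          · refine ho x hx y (hperm.mem_iff.2 ?_)
            simp only [List.mem_append, List.mem_singleton, hy', false_or] at hy ⊢
            tauto
      · rw [proj_append, hproj, ← List.singleton_append, flat_append, proj_append, hproj']
        simp only [flat_append, proj_append, flat_cons, flat_nil, List.append_nil, Move.acts,
          List.append_assoc]
        by_cases hk : k = q
        · subst hk
          rw [proj_flat_eq_nil h₄, List.append_nil, List.nil_append,
            ← List.singleton_append (l := [Action.recv p k m]), proj_append]
        · rw [proj_singleton_of_ne (a := Action.recv p q m) (fun h => hk h.symm), List.append_nil,
            ← List.singleton_append (l := [Action.recv p q m]), proj_append,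
            proj_singleton_of_ne (a := Action.recv p q m) (fun h => hk h.symm), List.append_nil]

theorem isRSC_of_not_borderline (hS : ¬ S.Borderline) : S.IsRSC := by
  rintro e ⟨γ, h⟩ C hC
  obtain ⟨l, hl, hproj⟩ := h.exists_ordered hS
  rw [hC.eq_setOf]
  exact ⟨flat l, {χ | IsInteraction (flat l) χ}, (matched_flat hl).isCommunication,
    isRSCExecution_flat hl _, causallyEquivalent_of_proj_eq h.matched (matched_flat hl) hproj⟩

end FIFOSystem

/-! ### Systems with a borderline execution are not RSC -/

theorem IsInteraction.isMatchingPair {e : List Action} {χ : Finset ℕ} (h : IsInteraction e χ)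
    {i j : ℕ} (hi : i ∈ χ) (hj : j ∈ χ) (hij : i < j) : IsMatchingPair e i j := by
  rcases h with ⟨a, b, hab, rfl⟩ | ⟨a, p, q, m, -, -, rfl⟩ | ⟨a, p, c, -, rfl⟩ <;>
    simp only [Finset.mem_insert, Finset.mem_singleton] at hi hj
  · have := hab.1
    obtain ⟨rfl, rfl⟩ : i = a ∧ j = b := by omega
    exact hab
  · omega
  · omega

/-- An interaction occupies at most two consecutive positions, so an edge from `j₁` to `j₂` gives
`sup χ₁ ≤ j₁ + 1 ≤ j₂ ≤ sup χ₂`. Equality throughout would put `j₂` in both interactions, which are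
disjoint when distinct. -/
theorem IsRSCExecution.sup_lt_sup {e : List Action} {C : Set (Finset ℕ)}
    (hC : IsCommunication e C) (h : IsRSCExecution e C) {χ₁ χ₂ : C}
    (hedge : ConflictEdge e C χ₁ χ₂) (hne : χ₁ ≠ χ₂) : χ₁.1.sup id < χ₂.1.sup id := by
  obtain ⟨j₁, h₁, j₂, h₂, hlt, hlen, -⟩ := hedge
  have hle : χ₁.1.sup id ≤ j₁ + 1 := by
    refine Finset.sup_le fun i hi => ?_
    by_contra hc
    rw [id, not_le] at hc
    have hp := (hC.1 _ χ₁.2).isMatchingPair h₁ hi (by omega)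
    have hmem : ({j₁, i} : Finset ℕ) ∈ C := by
      have := (hC.1 _ χ₁.2).eq_of_mem (Or.inl ⟨j₁, i, hp, rfl⟩) h₁ (by simp)
      exact this ▸ χ₁.2
    have := h _ _ hp hmem
    omega
  have hle₂ : j₂ ≤ χ₂.1.sup id := Finset.le_sup (f := id) h₂
  refine lt_of_le_of_ne (by omega) fun heq => hne (Subtype.ext ?_)
  obtain ⟨i, hi, hsup⟩ := Finset.exists_mem_eq_sup χ₁.1 ⟨j₁, h₁⟩ id
  obtain rfl : i = j₂ := by rw [id] at hsup; omega
  exact (hC.1 _ χ₁.2).eq_of_mem (hC.1 _ χ₂.2) hi h₂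

/-- An RSC execution schedules the interactions of every equivalent execution. -/
theorem exists_rank {e e' : List Action} {C' : Set (Finset ℕ)} (he : Matched e)
    (hC' : IsCommunication e' C') (hrsc : IsRSCExecution e' C')
    (heq : CausallyEquivalent e {χ | IsInteraction e χ} e' C') :
    ∃ r : ℕ → ℕ, (∀ i j, IsMatchingPair e i j → r i = r j) ∧
      ∀ i j, i < j → j < e.length → (e[i]?).map Action.proc = (e[j]?).map Action.proc →
        IsMatchingPair e i j ∨ r i < r j := by
  obtain ⟨f, -⟩ := heq
  have hex : ∀ j, ∃ χ : Finset ℕ, j < e.length → IsInteraction e χ ∧ j ∈ χ := fun j => by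
    by_cases hj : j < e.length
    · obtain ⟨χ, hχ, -⟩ := he.isCommunication.2 j hj
      exact ⟨χ, fun _ => hχ⟩
    · exact ⟨∅, fun h => absurd h hj⟩
  choose g hg using hex
  classical
  -- The rank of a position is the last position of the isomorphic image of its interaction; 0 past
  -- the end is a dummy value.
  refine ⟨fun j => if h : j < e.length then (f ⟨g j, (hg j h).1⟩).1.sup id else 0, ?_, ?_⟩
  · intro i j hij
    have hint : IsInteraction e {i, j} := Or.inl ⟨i, j, hij, rfl⟩
    have hi : i < e.length := hint.lt_length (by simp)
    have hj : j < e.length := hint.lt_length (by simp)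
    have h : g i = g j :=
      ((hg i hi).1.eq_of_mem hint (hg i hi).2 (by simp)).trans
        ((hg j hj).1.eq_of_mem hint (hg j hj).2 (by simp)).symm
    simp only [hi, hj, dif_pos, h]
  · intro i j hij hj hp
    have hi := hij.trans hj
    by_cases h : g i = g j
    · exact Or.inl ((hg i hi).1.isMatchingPair (hg i hi).2 (h ▸ (hg j hj).2) hij)
    · refine Or.inr ?_
      simp only [hi, hj, dif_pos]
      refine hrsc.sup_lt_sup hC' (f.map_rel_iff.2 ?_) ?_
      · exact ⟨i, (hg i hi).2, j, (hg j hj).2, hij, hj, fun hc => hc.1 hp⟩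
      · exact fun h' => h (congrArg Subtype.val (f.injective h'))

theorem recvMsgs_flat_eq_nil {p q : ℕ} {m : Msg} {l : List Move}
    (h : ∀ x ∈ l, (Move.lone p q m).Before x) : recvMsgs p q (flat l) = [] := by
  induction l with
  | nil => rfl
  | cons x l ih =>
    rw [flat_cons, recvMsgs_append, ih fun y hy => h y (by simp [hy]), List.append_nil]
    rcases x with ⟨p', q', m'⟩ | ⟨p', q', m'⟩ | ⟨p', c⟩
    · have : ¬ (p' = p ∧ q' = q) := h (Move.sync p' q' m') (by simp)
      simp [recvMsgs, Move.acts, this]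
    · rfl
    · rfl

/-- The processes that are causally after a send have an action that is scheduled after it. -/
theorem exists_rank_ge_of_mem_spread {e : List Action} {r : ℕ → ℕ}
    (hr : ∀ i j, IsMatchingPair e i j → r i = r j)
    (hr' : ∀ i j, i < j → j < e.length → (e[i]?).map Action.proc = (e[j]?).map Action.proc →
      r i ≤ r j)
    {l₁ l₂ : List Move} {p q : ℕ} {m : Msg} {rest : List Action}
    (hl : Ordered (l₁ ++ Move.lone p q m :: l₂))
    (he : e = flat (l₁ ++ Move.lone p q m :: l₂) ++ rest) {k : ℕ} (hk : k ∈ spread {p} l₂) :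
    ∃ i, i < (flat (l₁ ++ Move.lone p q m :: l₂)).length ∧ (e[i]?).map Action.proc = some k ∧
      r (flat l₁).length ≤ r i := by
  induction l₂ using List.reverseRecOn generalizing rest k with
  | nil =>
    obtain rfl : k = p := hk
    refine ⟨(flat l₁).length, by simp [Move.acts], ?_, le_rfl⟩
    rw [he]
    simp [Move.acts, Action.proc]
  | append_singleton l x ih =>
    have hassoc : l₁ ++ Move.lone p q m :: (l ++ [x]) = (l₁ ++ Move.lone p q m :: l) ++ [x] := by
      simp
    rw [hassoc] at hl he ⊢
    have ih' : ∀ {k}, k ∈ spread {p} l → ∃ i, i < (flat (l₁ ++ Move.lone p q m :: l)).length ∧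
        (e[i]?).map Action.proc = some k ∧ r (flat l₁).length ≤ r i := fun hk =>
      ih (rest := x.acts ++ rest) (List.pairwise_append.1 hl).1
        (by rw [he, flat_append]; simp) hk
    generalize l₁ ++ Move.lone p q m :: l = L at hl he ih'
    have hk' : k ∈ x.spread (spread {p} l) := by simpa [spread] using hk
    have hmono : ∀ i, i < (flat L).length → i < (flat (L ++ [x])).length := fun i hi => by
      rw [flat_append, List.length_append]; omega
    have hold : k ∈ spread {p} l → ∃ i, i < (flat (L ++ [x])).length ∧
        (e[i]?).map Action.proc = some k ∧ r (flat l₁).length ≤ r i := fun h =>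
      (ih' h).imp fun i hi => ⟨hmono i hi.1, hi.2⟩
    rcases x with ⟨a, b, m'⟩ | _ | _
    · have hlen : (flat (L ++ [Move.sync a b m'])).length = (flat L).length + 2 := by
        simp [Move.acts]
      have hlen' : (flat L).length + 2 ≤ e.length := by
        rw [he, List.length_append, hlen]; omega
      have hsend : e[(flat L).length]? = some (Action.send a b m') := by
        rw [he]; simp [Move.acts]
      have hrecv₀ : (flat (L ++ [Move.sync a b m']))[(flat L).length + 1]? =
          some (Action.recv a b m') := by
        simp [Move.acts]
      have hrecv : e[(flat L).length + 1]? = some (Action.recv a b m') := by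
        rw [he, List.getElem?_append_left (by omega), hrecv₀]
      have hpair : r (flat L).length = r ((flat L).length + 1) := by
        obtain ⟨j, hj, hm⟩ := isMatchingPair_flat hl hrecv₀
        obtain rfl : j = (flat L).length := by omega
        refine hr _ _ ?_
        rw [he]
        exact hm.append rest
      -- The send and the receive have the same rank, so a bound obtained at either end passes to
      -- the other.
      rcases hk' with hk' | ⟨rfl, hk'⟩ | ⟨rfl, hk'⟩
      · exact hold hk'
      · obtain ⟨i, hi, hp, hri⟩ := ih' hk'
        refine ⟨(flat L).length + 1, by omega, by rw [hrecv]; rfl, ?_⟩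
        rw [← hpair]
        exact hri.trans (hr' _ _ hi (by omega) (by rw [hp, hsend]; rfl))
      · obtain ⟨i, hi, hp, hri⟩ := ih' hk'
        refine ⟨(flat L).length, by omega, by rw [hsend]; rfl, ?_⟩
        rw [hpair]
        exact hri.trans (hr' _ _ (by omega) (by omega) (by rw [hp, hrecv]; rfl))
    · exact hold hk'
    · exact hold hk'

namespace FIFOSystem

variable {S : FIFOSystem}

/-- Some action of `q` before the new receive is ranked at least as high as the send of `m`. The
receive must be ranked strictly above that action, yet it has the rank of its send. -/
theorem Borderline.not_isRSC (hS : S.WellFormed) (h : S.Borderline) : ¬ S.IsRSC := by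
  obtain ⟨l, σ, p, q, m, s, hl, hσ, ⟨l₁, l₂, rfl, hl₁, hq⟩, hs⟩ := h
  have hne : p ≠ q := (validChannel_of_mem_delta hS hs).2.2
  have hlone := loneMsgs_eq_nil_iff.2 hl₁
  have hrun := (hσ.run_flat hl).concat (.recv _ p q m s (loneMsgs p q l₂) hs (by
    change loneMsgs p q (l₁ ++ Move.lone p q m :: l₂) = _
    rw [← List.singleton_append (l := l₂), loneMsgs_append, loneMsgs_append, hlone]
    simp [loneMsgs]))
  intro hrsc
  obtain ⟨e', C', hC', he', heq⟩ := hrsc _ ⟨_, hrun⟩ _ hrun.matched.isCommunication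
  obtain ⟨r, hr, hr'⟩ := exists_rank hrun.matched hC' he' heq
  obtain ⟨i, hi, hp, hri⟩ := exists_rank_ge_of_mem_spread hr
    (fun i j hij hj hp => (hr' i j hij hj hp).elim (fun h => (hr i j h).le) le_of_lt) hl rfl hq
  have hmatch : IsMatchingPair (flat (l₁ ++ Move.lone p q m :: l₂) ++ [Action.recv p q m])
      (flat l₁).length (flat (l₁ ++ Move.lone p q m :: l₂)).length := by
    have hflat : flat (l₁ ++ Move.lone p q m :: l₂) =
        flat l₁ ++ Action.send p q m :: flat l₂ := by simp [Move.acts]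
    rw [hflat]
    refine isMatchingPair_concat_recv ?_
    obtain ⟨ho₁, ho₂, -⟩ := List.pairwise_append.1 hl
    rw [sendMsgs_flat ho₁, hlone, ← List.singleton_append (l := flat l₂), recvMsgs_append,
      recvMsgs_append, recvMsgs_flat_eq_nil (List.pairwise_cons.1 ho₂).1]
    rfl
  -- The exceptional case, in which action `i` is itself the matching send, would make `p` equal to
  -- `q`.
  rcases hr' i _ hi (by simp) (by rw [hp]; simp [Action.proc]) with h | h
  · obtain rfl := h.left_unique hmatch
    refine hne (Option.some.inj ?_)
    rw [← hp]
    simp [Move.acts, Action.proc]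
  · rw [← hr _ _ hmatch] at h
    omega

end FIFOSystem

end CrashFIFO

/-! ### Decidability of RSC -/

theorem theorem4 :
    ∃ decideRSC : CrashFIFO.FIFOSystem → Bool, Computable decideRSC ∧
      ∀ (S : CrashFIFO.FIFOSystem) (R : Set ℕ), S.WellFormed → S.IsCrashHandling R →
        (decideRSC S = true ↔ S.IsRSC) := by
  obtain ⟨f, hf, h⟩ := CrashFIFO.exists_computable_borderline
  refine ⟨f, hf, fun S R hS _ => (h S hS).trans
    ⟨CrashFIFO.FIFOSystem.isRSC_of_not_borderline, fun hrsc hb => hb.not_isRSC hS hrsc⟩⟩
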